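/- Let $A=\begin{pmatrix}4&2\\2&12\end{pmatrix}$ and $B=\begin{pmatrix}4&2\\2&13\end{pmatrix}$. For a $k\times k$ integer matrix $C$ with $k\ge 1$ and first row $(c_{11},\dots,c_{1k})$, and for $y\in\mathbb Z$, let $\phi_k(C,y)$ be the symmetrically bordered $(k+3)\times(k+3)$ matrix $$\phi_k(C,y)=\left(\begin{array}{c|c|c}4y^2 & v^\top & w^\top\\ \hline v & C & 0\\ \hline w & 0 & A\end{array}\right),\qquad v=(c_{11},\dots,c_{1k})^\top,\quad w=(4,2)^\top .$$ Given integers $y^{(1)},y^{(2)},\dots$, define $(3g-1)\times(3g-1)$ matrices $M_g$ for $g\ge 1$ by $M_1=B$ and $M_{g+1}=\phi_{3g-1}(M_g,y^{(g)})$. For $y\in\mathbb Z$ let $N_g$ be the $3g\times 3g$ matrix $$N_g=\left(\begin{array}{c|c}y^2 & \tfrac12 u^\top\\ \hline \tfrac12 u & M_g\end{array}\right),$$ where $u^\top$ is the first row of $M_g$ (all of whose entries are even). Let $1<g\le 200$ and let $y^{(i)}=i+1$ for $i=1,\dots,g-1$. Then the characteristic polynomial of $M_g$ is irreducible over $\mathbb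 Q$. Moreover, for $y=g+1$, the characteristic polynomial of $N_g$ is irreducible over $\mathbb Q$. -/

import Mathlib

namespace ExplicitMulticurve

/-- The first row of a square matrix. -/
def firstRow {k : ℕ} (C : Matrix (Fin k) (Fin k) ℤ) : Fin k → ℤ :=
  fun j => C ⟨0, j.pos⟩ j

/-- The symmetric bordering of the square matrix `D` by the vector `v` and the corner entry `a`:
the block matrix with rows `(a | vᵀ)` and `(v | D)`. -/
def bordered {n : ℕ} (a : ℤ) (v : Fin n → ℤ) (D : Matrix (Fin n) (Fin n) ℤ) :
    Matrix (Fin (n + 1)) (Fin (n + 1)) ℤ :=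
  Matrix.of (Fin.cons (Fin.cons a v) (fun i => Fin.cons (v i) (D i)))

/-- The block diagonal matrix with diagonal blocks `C` and `D`. -/
def blockDiag {m n : ℕ} (C : Matrix (Fin m) (Fin m) ℤ) (D : Matrix (Fin n) (Fin n) ℤ) :
    Matrix (Fin (m + n)) (Fin (m + n)) ℤ :=
  (Matrix.fromBlocks C 0 0 D).submatrix finSumFinEquiv.symm finSumFinEquiv.symm

/-- The `2 × 2` block glued on at each inductive step. -/
def matA : Matrix (Fin 2) (Fin 2) ℤ := !![4, 2; 2, 12]

/-- The `2 × 2` starting matrix. -/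
def matB : Matrix (Fin 2) (Fin 2) ℤ := !![4, 2; 2, 13]

/-- The inductive step: the corner entry is `4 y ^ 2`, the border consists of the first row of `C`
followed by the first row of `A`, and the diagonal blocks are `C` and `A`. -/
def phi (k : ℕ) (C : Matrix (Fin k) (Fin k) ℤ) (y : ℤ) : Matrix (Fin (k + 3)) (Fin (k + 3)) ℤ :=
  bordered (4 * y ^ 2) (Fin.append (firstRow C) (firstRow matA)) (blockDiag C matA)

/-- The `(3 g - 1) × (3 g - 1)` matrix built from `B` by applying
`phi (3 * i - 1) · (y i)` successively for `i = 1, …, g - 1`. (The value at `g = 0` is the empty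
matrix.) -/
def matM (y : ℕ → ℤ) : (g : ℕ) → Matrix (Fin (3 * g - 1)) (Fin (3 * g - 1)) ℤ
  | 0 => 0
  | 1 => matB
  | g + 2 => phi (3 * (g + 1) - 1) (matM y (g + 1)) (y (g + 1))

/-- The matrix of the closed surface obtained from the matrix `C`: the corner entry is `z ^ 2` and
the border is half of the first row of `C`. It is applied to matrices whose first row is even, so
the integer division is exact, see `two_dvd_firstRow_matM`. -/
def closeUp {k : ℕ} (C : Matrix (Fin k) (Fin k) ℤ) (z : ℤ) :
    Matrix (Fin (k + 1)) (Fin (k + 1)) ℤ :=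
  bordered (z ^ 2) (fun j => firstRow C j / 2) C

/-- The `3 g × 3 g` matrix obtained by closing up `matM y g`. -/
def matN (y : ℕ → ℤ) (g : ℕ) (z : ℤ) :
    Matrix (Fin (3 * g - 1 + 1)) (Fin (3 * g - 1 + 1)) ℤ :=
  closeUp (matM y g) z

theorem two_dvd_firstRow_matM (y : ℕ → ℤ) (g : ℕ) (j : Fin (3 * g - 1)) :
    2 ∣ firstRow (matM y g) j := by
  induction g using Nat.twoStepInduction with
  | zero => exact j.elim0
  | one => exact (by decide : ∀ j : Fin 2, 2 ∣ firstRow matB j) j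
  | more g _ ih =>
    have key : ∀ j : Fin (3 * (g + 1) - 1 + 2 + 1),
        2 ∣ (Fin.cons (4 * y (g + 1) ^ 2)
          (Fin.append (firstRow (matM y (g + 1))) (firstRow matA)) : Fin _ → ℤ) j := by
      intro j
      refine Fin.cases ?_ (fun j => ?_) j
      · exact ⟨2 * y (g + 1) ^ 2, by simp; ring⟩
      · rw [Fin.cons_succ]
        refine Fin.addCases (fun j => ?_) (fun j => ?_) j
        · rw [Fin.append_left]; exact ih j
        · rw [Fin.append_right]; revert j; decide
    exact key j

end ExplicitMulticurve

/-! Let P be the characteristic polynomial of M_g and Q the (1,1) cofactor of X - M_g. For a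
symmetric matrix C with characteristic polynomial χ, the vector u = X · adj(X - C) e₁ - χ e₁ solves
(X - C) u = χ · (first row of C). Hence, when a border is built from first rows of symmetric blocks,
the quadratic term in the bordered determinant involves only P, Q and the corner entry of each
block. This gives explicit rules for both bordering constructions (`HasCornerData.phi`,
`HasCornerData.closeUp`). For the given y^(i) they become the recursion `charpolyPair`, with 4 times
the characteristic polynomial of N_g a combination of P and Q.

Both characteristic polynomials are monic over ℤ, so by Gauss's lemma irreducibility modulo one
prime p suffices. A prime is listed for each of the 2 · 199 polynomials, and irreducibility modulo p
follows from Rabin's criterion (`irreducible_of_rabin`): f of degree n is irreducible if it divides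
X^(p^n) - X and is coprime to a product of polynomials X^(p^e) - X whose exponents e cover the
proper divisors of n.

Degrees reach 600, so the test has to be cheap to evaluate. A polynomial modulo p is stored as one
natural number, the value at 2^w of a lift to ℕ[X] (Kronecker substitution, `Packs`). A product of
polynomials is then one product of integers, and all coefficients are reduced modulo p at once
(`Packs.packedMod`). Remainders modulo f use Barrett's method with a precomputed quotient
(`PacksMod.mulMod`). The powers X^(p^e) come from modular compositions along an addition chain for n
(`packedComp_spec`), and coprimality from a Euclidean algorithm without inversions
(`exists_C_mem_of_packedCoprime`). Only soundness is proved: a test that returns `true` implies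
irreducibility, and the listed certificates are evaluated. -/

/-! ### Characteristic polynomials of bordered and block diagonal matrices -/

open Polynomial in
theorem adjugate_charmatrix_bordered_zero {n : ℕ} (a : ℤ) (v : Fin n → ℤ)
    (D : Matrix (Fin n) (Fin n) ℤ) :
    (ExplicitMulticurve.bordered a v D).charmatrix.adjugate 0 0 = D.charpoly := by
  rw [Matrix.adjugate_fin_succ_eq_det_submatrix, Matrix.charpoly]
  simp only [Fin.val_zero, add_zero, pow_zero, one_mul]
  congr 1
  ext i j : 2
  simp [ExplicitMulticurve.bordered, Matrix.charmatrix_apply, Matrix.diagonal_apply]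

-- Apply X - M, with M the bordered matrix, to the vector (s χ_D, u): all entries but the first
-- cancel, and the first is the right-hand side. Multiplying by the adjugate, whose corner is χ_D,
-- and cancelling the monic χ_D gives the formula. The factor `s` allows a border that is a fraction
-- of a first row.
open Polynomial in
theorem mul_charpoly_bordered {n : ℕ} (a : ℤ) (v : Fin n → ℤ) (D : Matrix (Fin n) (Fin n) ℤ)
    (s : ℤ[X]) (u : Fin n → ℤ[X])
    (hu : D.charmatrix.mulVec u = fun i => s * D.charpoly * C (v i)) :
    s * (ExplicitMulticurve.bordered a v D).charpoly =
      s * (X - C a) * D.charpoly - ∑ j, C (v j) * u j := by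
  set N := (ExplicitMulticurve.bordered a v D).charmatrix with hN
  set c : Fin (n + 1) → ℤ[X] := Fin.cons (s * D.charpoly) u with hc
  set t : ℤ[X] := s * (X - C a) * D.charpoly - ∑ j, C (v j) * u j with ht
  have hminor : N.adjugate 0 0 = D.charpoly := adjugate_charmatrix_bordered_zero a v D
  have hNc : N.mulVec c = fun i => if i = 0 then t else 0 := by
    funext i
    refine Fin.cases ?_ (fun i => ?_) i
    · simp [Matrix.mulVec, dotProduct, Fin.sum_univ_succ, hN, hc, ht, Matrix.charmatrix_apply,
        ExplicitMulticurve.bordered, Matrix.diagonal_apply, (Fin.succ_ne_zero _).symm, sub_eq_add_neg]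
      ring
    · have := congrFun hu i
      simp only [Matrix.mulVec, dotProduct] at this
      have hD : ∀ j, N i.succ j.succ = D.charmatrix i j := fun j => by
        simp [hN, ExplicitMulticurve.bordered, Matrix.charmatrix_apply, Matrix.diagonal_apply]
      simp only [Matrix.mulVec, dotProduct, Fin.sum_univ_succ, hc, Fin.cons_zero, Fin.cons_succ, hD,
        this, Fin.succ_ne_zero, if_false]
      simp [hN, ExplicitMulticurve.bordered]
      ring
  have key : (N.adjugate.mulVec (N.mulVec c)) 0 = N.det * c 0 := by
    rw [Matrix.mulVec_mulVec, Matrix.adjugate_mul, Matrix.smul_mulVec, Matrix.one_mulVec]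
    rfl
  rw [hNc] at key
  simp only [Matrix.mulVec, dotProduct, mul_ite, mul_zero, Finset.sum_ite_eq', Finset.mem_univ,
    if_true, hminor, hc, Fin.cons_zero] at key
  have h0 : D.charpoly ≠ 0 := D.charpoly_monic.ne_zero
  refine mul_left_cancel₀ h0 ?_
  have hdet : N.det = (ExplicitMulticurve.bordered a v D).charpoly := rfl
  rw [key, hdet]
  ring

theorem isSymm_bordered {n : ℕ} (a : ℤ) (v : Fin n → ℤ) {D : Matrix (Fin n) (Fin n) ℤ}
    (hD : D.IsSymm) : (ExplicitMulticurve.bordered a v D).IsSymm := by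
  ext i j
  refine Fin.cases ?_ (fun i => ?_) i <;> refine Fin.cases ?_ (fun j => ?_) j
  · rfl
  · rfl
  · rfl
  · exact hD.apply i j

theorem isSymm_blockDiag {m n : ℕ} {C : Matrix (Fin m) (Fin m) ℤ} {D : Matrix (Fin n) (Fin n) ℤ}
    (hC : C.IsSymm) (hD : D.IsSymm) : (ExplicitMulticurve.blockDiag C D).IsSymm :=
  (Matrix.IsSymm.fromBlocks hC (by simp) hD).submatrix _

open Polynomial in
theorem charpoly_blockDiag {m n : ℕ} (C : Matrix (Fin m) (Fin m) ℤ) (D : Matrix (Fin n) (Fin n) ℤ) :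
    (ExplicitMulticurve.blockDiag C D).charpoly = C.charpoly * D.charpoly := by
  rw [← Matrix.charpoly_fromBlocks_zero₁₂ C 0 D]
  exact Matrix.charpoly_reindex finSumFinEquiv _

open Polynomial in
theorem charmatrix_blockDiag_mulVec_append {m n : ℕ} (C : Matrix (Fin m) (Fin m) ℤ)
    (D : Matrix (Fin n) (Fin n) ℤ) (u : Fin m → ℤ[X]) (v : Fin n → ℤ[X]) :
    (ExplicitMulticurve.blockDiag C D).charmatrix.mulVec (Fin.append u v) =
      Fin.append (C.charmatrix.mulVec u) (D.charmatrix.mulVec v) := by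
  have e : (ExplicitMulticurve.blockDiag C D).charmatrix =
      (Matrix.fromBlocks C.charmatrix 0 0 D.charmatrix).submatrix finSumFinEquiv.symm
        finSumFinEquiv.symm := by
    have := Matrix.charmatrix_reindex (e := finSumFinEquiv) (M := Matrix.fromBlocks C 0 0 D)
    rw [Matrix.charmatrix_fromBlocks] at this
    simp only [Matrix.reindex_apply, neg_zero, Matrix.map_zero, map_zero] at this
    exact this
  rw [e]
  funext i
  refine Fin.addCases (fun i => ?_) (fun i => ?_) i <;>
    simp [Matrix.mulVec, dotProduct, Fin.sum_univ_add]

/-! ### The recursion for the characteristic polynomials -/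

open Polynomial in
/-- A vector solving `(X - C) u = charpoly C • (first row of C)`. -/
noncomputable def rowSolution {k : ℕ} (hk : 0 < k) (C : Matrix (Fin k) (Fin k) ℤ) : Fin k → ℤ[X] :=
  fun i => X * C.charmatrix.adjugate i ⟨0, hk⟩ - if i = ⟨0, hk⟩ then C.charpoly else 0

open Polynomial in
theorem C_firstRow_eq {k : ℕ} (hk : 0 < k) (M : Matrix (Fin k) (Fin k) ℤ) (j : Fin k) :
    C (ExplicitMulticurve.firstRow M j) = (if j = ⟨0, hk⟩ then X else 0) -
      M.charmatrix ⟨0, hk⟩ j := by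
  simp [Matrix.charmatrix_apply, Matrix.diagonal_apply, ExplicitMulticurve.firstRow, eq_comm]

theorem isSymm_charmatrix {k : ℕ} {M : Matrix (Fin k) (Fin k) ℤ} (hM : M.IsSymm) (i j : Fin k) :
    M.charmatrix i j = M.charmatrix j i := by
  rw [Matrix.charmatrix_apply, Matrix.charmatrix_apply, hM.apply j i, Matrix.diagonal_apply,
    Matrix.diagonal_apply]
  by_cases h : i = j
  · simp [h]
  · simp [h, Ne.symm h]

-- Since (X - M) adj(X - M) = χ, the image of the vector is χ X e₁ - χ (X - M) e₁ = χ M e₁. By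
-- symmetry the first column M e₁ is the first row.
open Polynomial in
theorem charmatrix_mulVec_rowSolution {k : ℕ} (hk : 0 < k) {M : Matrix (Fin k) (Fin k) ℤ}
    (hM : M.IsSymm) :
    M.charmatrix.mulVec (rowSolution hk M) =
      fun i => M.charpoly * C (ExplicitMulticurve.firstRow M i) := by
  funext i
  have h := congrFun (congrFun (Matrix.mul_adjugate M.charmatrix) i) ⟨0, hk⟩
  rw [Matrix.mul_apply] at h
  rw [C_firstRow_eq hk, isSymm_charmatrix hM ⟨0, hk⟩ i]
  simp only [Matrix.mulVec, dotProduct, rowSolution, mul_sub, Finset.sum_sub_distrib, mul_ite,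
    mul_zero, Finset.sum_ite_eq', Finset.mem_univ, if_true]
  have : ∑ x, M.charmatrix i x * (X * M.charmatrix.adjugate x ⟨0, hk⟩) =
      X * ∑ x, M.charmatrix i x * M.charmatrix.adjugate x ⟨0, hk⟩ := by
    rw [Finset.mul_sum]; exact Finset.sum_congr rfl fun x _ => by ring
  rw [this, h, Matrix.smul_apply, Matrix.one_apply]
  change X * (M.charpoly • _) - _ = _
  split_ifs <;> simp [mul_comm]

-- By `C_firstRow_eq` the first row of M is X e₁ᵀ minus the first row of X - M, and the latter pairs
-- with the first column of the adjugate to χ.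
open Polynomial in
theorem sum_firstRow_mul_rowSolution {k : ℕ} (hk : 0 < k) (M : Matrix (Fin k) (Fin k) ℤ) :
    ∑ j, C (ExplicitMulticurve.firstRow M j) * rowSolution hk M j =
      X ^ 2 * M.charmatrix.adjugate ⟨0, hk⟩ ⟨0, hk⟩ - (X + C (M ⟨0, hk⟩ ⟨0, hk⟩)) * M.charpoly := by
  have h : ∑ j, M.charmatrix ⟨0, hk⟩ j * M.charmatrix.adjugate j ⟨0, hk⟩ = M.charpoly := by
    have := congrFun (congrFun (Matrix.mul_adjugate M.charmatrix) ⟨0, hk⟩) ⟨0, hk⟩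
    rw [Matrix.mul_apply, Matrix.smul_apply, Matrix.one_apply_eq, smul_eq_mul, mul_one] at this
    exact this
  have h1 : ∑ j, C (ExplicitMulticurve.firstRow M j) * (X * M.charmatrix.adjugate j ⟨0, hk⟩) =
      X * (X * M.charmatrix.adjugate ⟨0, hk⟩ ⟨0, hk⟩ - M.charpoly) := by
    have e : ∀ j, C (ExplicitMulticurve.firstRow M j) * (X * M.charmatrix.adjugate j ⟨0, hk⟩) =
        (if j = ⟨0, hk⟩ then X * (X * M.charmatrix.adjugate j ⟨0, hk⟩) else 0) -
          X * (M.charmatrix ⟨0, hk⟩ j * M.charmatrix.adjugate j ⟨0, hk⟩) := fun j => by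
      rw [C_firstRow_eq hk]
      split_ifs <;> ring
    rw [Finset.sum_congr rfl fun j _ => e j, Finset.sum_sub_distrib, ← Finset.mul_sum, h,
      Finset.sum_ite_eq' , if_pos (Finset.mem_univ _), mul_sub]
  simp only [rowSolution, mul_sub, Finset.sum_sub_distrib, mul_ite, mul_zero, Finset.sum_ite_eq',
    Finset.mem_univ, if_true, h1]
  have : ExplicitMulticurve.firstRow M ⟨0, hk⟩ = M ⟨0, hk⟩ ⟨0, hk⟩ := rfl
  rw [this]
  ring

open Polynomial in
/-- `M` is symmetric with characteristic polynomial `P`, principal cofactor `Q` of `X - M`, and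
corner entry `m`. -/
def HasCornerData {k : ℕ} (M : Matrix (Fin k) (Fin k) ℤ) (P Q : ℤ[X]) (m : ℤ) : Prop :=
  ∃ hk : 0 < k, M.IsSymm ∧ M.charpoly = P ∧ M.charmatrix.adjugate ⟨0, hk⟩ ⟨0, hk⟩ = Q ∧
    M ⟨0, hk⟩ ⟨0, hk⟩ = m

open Polynomial in
theorem hasCornerData_matA :
    HasCornerData ExplicitMulticurve.matA (X ^ 2 - 16 * X + 44) (X - 12) 4 := by
  refine ⟨by norm_num, by decide, ?_, ?_, rfl⟩
  · rw [Matrix.charpoly_fin_two]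
    simp [ExplicitMulticurve.matA, Matrix.trace_fin_two, Matrix.det_fin_two]
  · change Matrix.adjugate _ (0 : Fin 2) 0 = _
    simp [Matrix.adjugate_fin_two, ExplicitMulticurve.matA]

open Polynomial in
theorem hasCornerData_matB :
    HasCornerData ExplicitMulticurve.matB (X ^ 2 - 17 * X + 48) (X - 13) 4 := by
  refine ⟨by norm_num, by decide, ?_, ?_, rfl⟩
  · rw [Matrix.charpoly_fin_two]
    simp [ExplicitMulticurve.matB, Matrix.trace_fin_two, Matrix.det_fin_two]
  · change Matrix.adjugate _ (0 : Fin 2) 0 = _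
    simp [Matrix.adjugate_fin_two, ExplicitMulticurve.matB]

open Polynomial in
theorem HasCornerData.phi {k : ℕ} {M : Matrix (Fin k) (Fin k) ℤ} {P Q : ℤ[X]} {m : ℤ}
    (h : HasCornerData M P Q m) (y : ℤ) :
    HasCornerData (ExplicitMulticurve.phi k M y)
      ((X ^ 2 - 16 * X + 44) * P * (3 * X + C (m + 4 - 4 * y ^ 2)) -
        (X ^ 2 - 16 * X + 44) * (X ^ 2 * Q) - P * (X ^ 2 * (X - 12)))
      ((X ^ 2 - 16 * X + 44) * P) (4 * y ^ 2) := by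
  obtain ⟨hk, hs, hP, hQ, hm⟩ := h
  obtain ⟨hA0, hAs, hAP, hAQ, hAm⟩ := hasCornerData_matA
  have hc : (ExplicitMulticurve.blockDiag M ExplicitMulticurve.matA).charpoly =
      P * (X ^ 2 - 16 * X + 44) := by rw [charpoly_blockDiag, hP, hAP]
  refine ⟨by omega, isSymm_bordered _ _ (isSymm_blockDiag hs hAs), ?_, ?_, rfl⟩
  -- The system for the block diagonal matrix splits. Each block's solution is scaled by the
  -- characteristic polynomial of the other block, because the right-hand side carries the product
  -- of the two.
  · have hb := mul_charpoly_bordered (4 * y ^ 2) (Fin.append (ExplicitMulticurve.firstRow M)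
      (ExplicitMulticurve.firstRow ExplicitMulticurve.matA))
      (ExplicitMulticurve.blockDiag M ExplicitMulticurve.matA) 1
      (Fin.append ((X ^ 2 - 16 * X + 44 : ℤ[X]) • rowSolution hk M)
        (P • rowSolution hA0 ExplicitMulticurve.matA)) ?_
    · rw [one_mul, one_mul] at hb
      rw [ExplicitMulticurve.phi, hb, hc, Fin.sum_univ_add]
      simp only [Fin.append_left, Fin.append_right, Pi.smul_apply, smul_eq_mul,
        mul_left_comm (C _), ← Finset.mul_sum]
      rw [sum_firstRow_mul_rowSolution, sum_firstRow_mul_rowSolution, hP, hQ, hm, hAP, hAQ, hAm]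
      simp only [map_add, map_sub]
      have : (C 4 : ℤ[X]) = 4 := rfl
      rw [this]
      ring
    · rw [charmatrix_blockDiag_mulVec_append, Matrix.mulVec_smul, Matrix.mulVec_smul,
        charmatrix_mulVec_rowSolution hk hs, charmatrix_mulVec_rowSolution hA0 hAs, hc, hP, hAP]
      funext i
      refine Fin.addCases (fun i => ?_) (fun i => ?_) i
      · simp only [Fin.append_left, Pi.smul_apply, smul_eq_mul]; ring
      · simp only [Fin.append_right, Pi.smul_apply, smul_eq_mul]; ring
  · rw [mul_comm, ← hc]
    exact adjugate_charmatrix_bordered_zero _ _ _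

open Polynomial in
theorem HasCornerData.closeUp {k : ℕ} {M : Matrix (Fin k) (Fin k) ℤ} {P Q : ℤ[X]} {m : ℤ}
    (h : HasCornerData M P Q m) (he : ∀ j, 2 ∣ ExplicitMulticurve.firstRow M j) (z : ℤ) :
    4 * (ExplicitMulticurve.closeUp M z).charpoly =
      P * (5 * X + C (m - 4 * z ^ 2)) - X ^ 2 * Q := by
  obtain ⟨hk, hs, hP, hQ, hm⟩ := h
  have hhalf : ∀ j, C (ExplicitMulticurve.firstRow M j) =
      2 * C (ExplicitMulticurve.firstRow M j / 2) := fun j => by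
    have : (2 : ℤ[X]) = C 2 := rfl
    rw [this, ← C_mul, Int.mul_ediv_cancel' (he j)]
  have hsum := sum_firstRow_mul_rowSolution hk M
  have hvec := charmatrix_mulVec_rowSolution hk hs
  -- The border is half the first row, so the solution for the full first row is the one for `s =
  -- 2`. Halving the border in the sum as well accounts for the factor 4.
  have h2 := mul_charpoly_bordered (z ^ 2) (fun j => ExplicitMulticurve.firstRow M j / 2) M 2
    (rowSolution hk M) (by rw [hvec]; funext i; rw [hhalf]; ring)
  simp only [hhalf, mul_assoc, ← Finset.mul_sum] at hsum
  rw [hP, hQ, hm] at hsum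
  rw [hP] at h2
  have h4 : C (m - 4 * z ^ 2) = C m - 4 * C (z ^ 2) := by
    rw [C_sub, C_mul]; rfl
  rw [h4, ExplicitMulticurve.closeUp]
  linear_combination 2 * h2 - hsum

open Polynomial in
/-- The pairs (characteristic polynomial, principal cofactor) of `X - matM y (k + 1)` when
`y i = i + 1`. -/
noncomputable def charpolyPair : ℕ → ℤ[X] × ℤ[X]
  | 0 => (X ^ 2 - 17 * X + 48, X - 13)
  | k + 1 =>
    ((charpolyPair k).1 * (2 * X ^ 3 - C (36 + 8 * (k + 1 : ℤ)) * X ^ 2 +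
        C (132 + 128 * (k + 1 : ℤ)) * X - C (352 * (k + 1 : ℤ))) -
      (charpolyPair k).2 * (X ^ 2 * (X ^ 2 - 16 * X + 44)),
      (charpolyPair k).1 * (X ^ 2 - 16 * X + 44))

/-- The corner entry 4 of B is 4 · 1², so the formula for the corner also holds at the start. From
there 4(k+1)² + 4 - 4(k+2)² = -8(k+1), which is why the coefficients of `charpolyPair` are linear in
k. -/
theorem hasCornerData_matM (y : ℕ → ℤ) (k : ℕ) (hy : ∀ i, 1 ≤ i → i ≤ k → y i = (i : ℤ) + 1) :
    HasCornerData (ExplicitMulticurve.matM y (k + 1)) (charpolyPair k).1 (charpolyPair k).2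
      (4 * (k + 1 : ℤ) ^ 2) := by
  induction k with
  | zero =>
    change HasCornerData ExplicitMulticurve.matB (Polynomial.X ^ 2 - 17 * Polynomial.X + 48)
      (Polynomial.X - 13) _
    simpa using hasCornerData_matB
  | succ k ih =>
    have h := (ih fun i h1 h2 => hy i h1 (by omega)).phi (y (k + 1))
    have hyk : y (k + 1) = (k : ℤ) + 1 + 1 := by
      rw [hy (k + 1) (by omega) le_rfl]; push_cast; ring
    rw [hyk] at h
    change HasCornerData (ExplicitMulticurve.phi (3 * (k + 1) - 1)
      (ExplicitMulticurve.matM y (k + 1)) (y (k + 1))) _ _ _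
    rw [hyk]
    convert h using 1
    · simp only [charpolyPair, map_add, map_sub, map_mul, map_pow, map_one, Polynomial.C_ofNat]
      ring
    · simp only [charpolyPair]; ring
    · push_cast; ring

theorem charpoly_matM (y : ℕ → ℤ) (k : ℕ) (hy : ∀ i, 1 ≤ i → i ≤ k → y i = (i : ℤ) + 1) :
    (ExplicitMulticurve.matM y (k + 1)).charpoly = (charpolyPair k).1 := by
  obtain ⟨_, _, h, _⟩ := hasCornerData_matM y k hy
  exact h

open Polynomial in
theorem four_mul_charpoly_matN (y : ℕ → ℤ) (k : ℕ)
    (hy : ∀ i, 1 ≤ i → i ≤ k → y i = (i : ℤ) + 1) :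
    4 * (ExplicitMulticurve.matN y (k + 1) ((k + 1 : ℕ) + 1)).charpoly =
      (charpolyPair k).1 * (5 * X - C (8 * (k + 1 : ℤ) + 4)) - X ^ 2 * (charpolyPair k).2 := by
  rw [ExplicitMulticurve.matN, (hasCornerData_matM y k hy).closeUp
    (ExplicitMulticurve.two_dvd_firstRow_matM y (k + 1))]
  push_cast
  simp only [map_add, map_sub, map_mul, map_pow, map_one, Polynomial.C_ofNat]
  ring

/-! ### Kronecker substitution: polynomials packed into natural numbers -/

open Polynomial in
/-- `N` is the value at `2 ^ w` of a polynomial with `L` natural coefficients, all at most `b`,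
that reduces to `P` modulo `p`. -/
def Packs {p : ℕ} (w L b N : ℕ) (P : (ZMod p)[X]) : Prop :=
  ∃ Q : ℕ[X], (∀ i, Q.coeff i ≤ b) ∧ (∀ i, L ≤ i → Q.coeff i = 0) ∧ Q.eval (2 ^ w) = N ∧
    Q.map (Nat.castRingHom (ZMod p)) = P

namespace Packs

variable {p w : ℕ}

open Polynomial in
theorem of_digits {L b N : ℕ} {P : (ZMod p)[X]} (c : ℕ → ℕ) (hb : ∀ i, c i ≤ b)
    (hL : ∀ i, L ≤ i → c i = 0) (hN : N = ∑ i ∈ Finset.range L, c i * (2 ^ w) ^ i)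
    (hP : ∀ i, P.coeff i = c i) : Packs w L b N P := by
  have hc : ∀ i, (∑ j ∈ Finset.range L, C (c j) * X ^ j : ℕ[X]).coeff i = c i := fun i => by
    rw [finsetSum_coeff]
    simp only [coeff_C_mul, coeff_X_pow, mul_ite, mul_one, mul_zero, Finset.sum_ite_eq,
      Finset.mem_range]
    split_ifs with h
    · rfl
    · exact (hL i (not_lt.1 h)).symm
  refine ⟨∑ j ∈ Finset.range L, C (c j) * X ^ j, fun i => by rw [hc]; exact hb i,
    fun i hi => by rw [hc]; exact hL i hi, ?_, ?_⟩
  · simp [eval_finsetSum, hN]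
  · ext i
    rw [coeff_map, hc, hP, eq_natCast]

open Polynomial in
theorem exists_digits {L b N : ℕ} {P : (ZMod p)[X]} (h : Packs w L b N P) :
    ∃ c : ℕ → ℕ, (∀ i, c i ≤ b) ∧ (∀ i, L ≤ i → c i = 0) ∧
      N = ∑ i ∈ Finset.range L, c i * (2 ^ w) ^ i ∧ ∀ i, P.coeff i = c i := by
  obtain ⟨Q, hb, hL, hN, rfl⟩ := h
  refine ⟨Q.coeff, hb, hL, ?_, fun i => by simp⟩
  rw [← hN]
  rcases Nat.eq_zero_or_pos L with rfl | h0
  · have : Q = 0 := by ext i; simp [hL i]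
    simp [this]
  · refine eval_eq_sum_range' ?_ _
    by_cases hQ : Q = 0
    · simpa [hQ] using h0
    · by_contra hlt
      exact hQ (leadingCoeff_eq_zero.1 (hL _ (not_lt.1 hlt)))

open Polynomial in
theorem mono {L L' b b' N : ℕ} {P : (ZMod p)[X]} (h : Packs w L b N P) (hL : L ≤ L')
    (hb : b ≤ b') : Packs w L' b' N P := by
  obtain ⟨Q, h1, h2, h3, h4⟩ := h
  exact ⟨Q, fun i => (h1 i).trans hb, fun i hi => h2 i (hL.trans hi), h3, h4⟩

open Polynomial in
theorem add {L b b' N N' : ℕ} {P P' : (ZMod p)[X]} (h : Packs w L b N P)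
    (h' : Packs w L b' N' P') : Packs w L (b + b') (N + N') (P + P') := by
  obtain ⟨Q, h1, h2, h3, h4⟩ := h
  obtain ⟨Q', h1', h2', h3', h4'⟩ := h'
  refine ⟨Q + Q', fun i => ?_, fun i hi => ?_, ?_, ?_⟩
  · rw [coeff_add]; exact add_le_add (h1 i) (h1' i)
  · rw [coeff_add, h2 i hi, h2' i hi]
  · rw [eval_add, h3, h3']
  · rw [Polynomial.map_add, h4, h4']

-- At most `L` terms of the convolution are nonzero, `L` being the length of the first factor.
-- Carries play no role: `Packs` bounds the coefficients of a lift, and `b < 2 ^ w` is needed only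
-- where digits are read off.
open Polynomial in
theorem mul {L L' b b' N N' : ℕ} {P P' : (ZMod p)[X]} (h : Packs w L b N P)
    (h' : Packs w L' b' N' P') : Packs w (L + L' - 1) (L * (b * b')) (N * N') (P * P') := by
  obtain ⟨Q, h1, h2, h3, h4⟩ := h
  obtain ⟨Q', h1', h2', h3', h4'⟩ := h'
  refine ⟨Q * Q', fun i => ?_, fun i hi => ?_, ?_, ?_⟩
  · rw [coeff_mul, Finset.Nat.sum_antidiagonal_eq_sum_range_succ (fun a b => Q.coeff a * Q'.coeff b)]
    calc ∑ k ∈ Finset.range i.succ, Q.coeff k * Q'.coeff (i - k)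
        ≤ ∑ k ∈ Finset.range i.succ, if k < L then b * b' else 0 := by
          refine Finset.sum_le_sum fun k _ => ?_
          split_ifs with hk
          · exact Nat.mul_le_mul (h1 k) (h1' _)
          · rw [h2 k (not_lt.1 hk), zero_mul]
      _ = ∑ k ∈ (Finset.range i.succ).filter (· < L), b * b' := (Finset.sum_filter _ _).symm
      _ ≤ ∑ k ∈ Finset.range L, b * b' := by
          refine Finset.sum_le_sum_of_subset fun k hk => ?_
          rw [Finset.mem_filter] at hk
          exact Finset.mem_range.2 hk.2
      _ = L * (b * b') := by simp
  · rw [coeff_mul]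
    refine Finset.sum_eq_zero fun x hx => ?_
    have := Finset.HasAntidiagonal.mem_antidiagonal.1 hx
    rcases le_or_gt L x.1 with h | h
    · rw [h2 _ h, zero_mul]
    · rw [h2' _ (by omega), mul_zero]
  · rw [eval_mul, h3, h3']
  · rw [Polynomial.map_mul, h4, h4']

open Polynomial in
theorem smul {L b b' N t : ℕ} {P : (ZMod p)[X]} (ht : t ≤ b') (h : Packs w L b N P) :
    Packs w L (b' * b) (t * N) (C (t : ZMod p) * P) := by
  obtain ⟨Q, h1, h2, h3, h4⟩ := h
  refine ⟨C t * Q, fun i => ?_, fun i hi => ?_, ?_, ?_⟩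
  · rw [coeff_C_mul]; exact Nat.mul_le_mul ht (h1 i)
  · rw [coeff_C_mul, h2 i hi, mul_zero]
  · rw [eval_mul, eval_C, h3]
  · rw [Polynomial.map_mul, h4, map_C, eq_natCast]

open Polynomial in
theorem zero (L b : ℕ) : Packs w L b 0 (0 : (ZMod p)[X]) :=
  ⟨0, by simp, by simp, by simp, by simp⟩

open Polynomial in
theorem const {L b d : ℕ} (hL : 0 < L) (hd : d ≤ b) : Packs w L b d (C (d : ZMod p)) := by
  refine ⟨C d, fun i => ?_, fun i hi => ?_, by simp, by simp⟩
  · rw [coeff_C]; split_ifs <;> omega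
  · rw [coeff_C, if_neg (by omega)]

open Polynomial in
theorem shiftLeft {L b N : ℕ} {P : (ZMod p)[X]} (k : ℕ) (h : Packs w L b N P) :
    Packs w (L + k) b (N <<< (w * k)) (X ^ k * P) := by
  obtain ⟨Q, h1, h2, h3, h4⟩ := h
  refine ⟨X ^ k * Q, fun i => ?_, fun i hi => ?_, ?_, ?_⟩
  · rw [coeff_X_pow_mul']; split_ifs
    · exact h1 _
    · exact Nat.zero_le _
  · rw [coeff_X_pow_mul', if_pos (by omega), h2 _ (by omega)]
  · rw [eval_mul, h3, eval_pow, eval_X, Nat.shiftLeft_eq, pow_mul, mul_comm]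
  · rw [Polynomial.map_mul, h4, Polynomial.map_pow, map_X]

open Polynomial in
theorem cons {L b N d : ℕ} {P : (ZMod p)[X]} (hd : d ≤ b) (h : Packs w L b N P) :
    Packs w (L + 1) b (d + N <<< w) (C (d : ZMod p) + X * P) := by
  obtain ⟨Q, h1, h2, h3, h4⟩ := h
  refine ⟨C d + X * Q, fun i => ?_, fun i hi => ?_, ?_, ?_⟩
  · cases i with
    | zero => simpa using hd
    | succ i => simpa using h1 i
  · cases i with
    | zero => omega
    | succ i => simpa using h2 i (by omega)
  · rw [eval_add, eval_C, eval_mul, eval_X, h3, Nat.shiftLeft_eq, mul_comm N]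
  · simp [h4]

theorem sum_digits_lt {b : ℕ} (c : ℕ → ℕ) (hb : ∀ i, c i ≤ b) (hw : b < 2 ^ w) (k : ℕ) :
    ∑ i ∈ Finset.range k, c i * (2 ^ w) ^ i < (2 ^ w) ^ k := by
  induction k with
  | zero => simp
  | succ k ih =>
    rw [Finset.sum_range_succ, pow_succ]
    have : c k + 1 ≤ 2 ^ w := (Nat.succ_le_succ (hb k)).trans hw
    nlinarith [Nat.mul_le_mul_right ((2 ^ w) ^ k) this]

theorem sum_digits_split (c : ℕ → ℕ) (k l : ℕ) :
    ∑ i ∈ Finset.range (k + l), c i * (2 ^ w) ^ i = ∑ i ∈ Finset.range k, c i * (2 ^ w) ^ i +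
      (2 ^ w) ^ k * ∑ i ∈ Finset.range l, c (k + i) * (2 ^ w) ^ i := by
  rw [Finset.sum_range_add, Finset.mul_sum]
  congr 1
  exact Finset.sum_congr rfl fun i _ => by rw [pow_add]; ring

-- Dropping `k` digits is division by X^k without remainder term. It needs `b < 2 ^ w`, so that the
-- `k` lowest coefficients together stay below 2^(wk).
open Polynomial in
theorem shiftRight {L b N : ℕ} {P : (ZMod p)[X]} (k : ℕ) (h : Packs w L b N P) (hw : b < 2 ^ w) :
    ∃ P' : (ZMod p)[X], Packs w (L - k) b (N >>> (w * k)) P' ∧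
      ∀ i, P'.coeff i = P.coeff (k + i) := by
  obtain ⟨c, h1, h2, h3, h4⟩ := h.exists_digits
  have key : ∀ i, (∑ j ∈ Finset.range (L - k), C ((c (k + j) : ℕ) : ZMod p) * X ^ j).coeff i =
      ((c (k + i) : ℕ) : ZMod p) := fun i => by
    rw [finsetSum_coeff]
    simp only [coeff_C_mul, coeff_X_pow, mul_ite, mul_one, mul_zero, Finset.sum_ite_eq,
      Finset.mem_range]
    split_ifs with h
    · rfl
    · rw [h2 _ (by omega), Nat.cast_zero]
  refine ⟨∑ i ∈ Finset.range (L - k), C ((c (k + i) : ℕ) : ZMod p) * X ^ i, ?_, ?_⟩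
  · refine of_digits (fun i => c (k + i)) (fun i => h1 _) (fun i hi => h2 _ (by omega)) ?_ key
    rw [Nat.shiftRight_eq_div_pow, pow_mul, h3]
    have hlt := sum_digits_lt c h1 hw k
    rcases le_or_gt k L with hk | hk
    · rw [show L = k + (L - k) by omega, sum_digits_split, Nat.add_mul_div_left _ _ (by positivity),
        Nat.div_eq_of_lt hlt, zero_add]
      simp
    · have hle : ∑ i ∈ Finset.range L, c i * (2 ^ w) ^ i ≤
          ∑ i ∈ Finset.range k, c i * (2 ^ w) ^ i :=
        Finset.sum_le_sum_of_subset (Finset.range_subset_range.2 hk.le)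
      rw [Nat.div_eq_of_lt (hle.trans_lt hlt), show L - k = 0 by omega, Finset.sum_range_zero]
  · intro i
    rw [key, h4]

open Polynomial in
theorem land_mask {L b N : ℕ} {P : (ZMod p)[X]} (h : Packs w L b N P) (hw : b < 2 ^ w) :
    N &&& (2 ^ w - 1) ≤ b ∧ ((N &&& (2 ^ w - 1) : ℕ) : ZMod p) = P.coeff 0 := by
  obtain ⟨c, h1, h2, h3, h4⟩ := h.exists_digits
  have : N &&& (2 ^ w - 1) = c 0 := by
    rw [Nat.and_two_pow_sub_one_eq_mod, h3]
    cases L with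
    | zero => simp [h2 0]
    | succ L =>
      rw [add_comm L 1, sum_digits_split]
      simp [Nat.add_mul_mod_self_left, Nat.mod_eq_of_lt ((h1 0).trans_lt hw)]
  rw [this, h4]
  exact ⟨h1 0, rfl⟩

open Polynomial in
theorem top_digit {n b N : ℕ} {P : (ZMod p)[X]} (h : Packs w (n + 1) b N P) (hw : b < 2 ^ w) :
    N >>> (w * n) ≤ b ∧ ((N >>> (w * n) : ℕ) : ZMod p) = P.coeff n := by
  obtain ⟨P', h', hP'⟩ := h.shiftRight n hw
  obtain ⟨c, h1, h2, h3, h4⟩ := h'.exists_digits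
  rw [show n + 1 - n = 1 by omega] at h3
  have h3' : N >>> (w * n) = c 0 := by rw [h3]; simp
  rw [h3', ← h4 0, hP']
  exact ⟨h1 0, rfl⟩

-- A digit below p that vanishes modulo p is zero, so for reduced numbers the length may be taken
-- from the degree of `P`. This shortens the length after a cancellation of leading terms.
open Polynomial in
theorem of_coeff_eq_zero [Fact p.Prime] {L L' N : ℕ} {P : (ZMod p)[X]} (h : Packs w L (p - 1) N P)
    (hP : ∀ i, L' ≤ i → P.coeff i = 0) : Packs w L' (p - 1) N P := by
  obtain ⟨Q, h1, h2, h3, h4⟩ := h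
  refine ⟨Q, h1, fun i hi => ?_, h3, h4⟩
  have := hP i hi
  rw [← h4, coeff_map, eq_natCast, ZMod.natCast_eq_zero_iff] at this
  refine Nat.eq_zero_of_dvd_of_lt this ?_
  have := h1 i
  have := (Fact.out : p.Prime).pos
  omega

open Polynomial in
theorem unique {L L' b N : ℕ} {P P' : (ZMod p)[X]} (h : Packs w L b N P) (h' : Packs w L' b N P')
    (hw : b < 2 ^ w) : P = P' := by
  ext i
  obtain ⟨R, hR, hRc⟩ := h.shiftRight i hw
  obtain ⟨R', hR', hRc'⟩ := h'.shiftRight i hw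
  rw [← add_zero i, ← hRc, ← hRc', ← (hR.land_mask hw).2, (hR'.land_mask hw).2]

end Packs

/-! ### Reduction of all packed coefficients modulo p at once -/

/-- Coefficientwise reduction modulo `p` of a packed polynomial. -/
def packedMod (s μ p mask N : ℕ) : ℕ :=
  Nat.sub N (Nat.mul p (Nat.land (Nat.shiftRight (Nat.mul N μ) s) mask))

/-- `k` digits in base `2 ^ w`, each equal to `2 ^ (w - s) - 1`. -/
def digitMask (w s k : ℕ) : ℕ :=
  Nat.mul (Nat.sub (Nat.pow 2 (Nat.sub w s)) 1)
    (Nat.div (Nat.sub (Nat.pow 2 (Nat.mul w k)) 1) (Nat.sub (Nat.pow 2 w) 1))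

theorem digitMask_eq {w : ℕ} (hw : 0 < w) (s k : ℕ) :
    digitMask w s k = ∑ i ∈ Finset.range k, (2 ^ (w - s) - 1) * (2 ^ w) ^ i := by
  rw [← Finset.mul_sum, Nat.geomSum_eq (Nat.one_lt_two_pow hw.ne'), ← pow_mul]
  rfl

theorem land_add_two_pow_mul {w : ℕ} (Z m M : ℕ) (hm : m < 2 ^ w) :
    Z &&& (m + 2 ^ w * M) = (Z % 2 ^ w &&& m) + 2 ^ w * (Z / 2 ^ w &&& M) := by
  have h1 : (Z &&& (m + 2 ^ w * M)) % 2 ^ w = Z % 2 ^ w &&& m := by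
    rw [Nat.and_mod_two_pow, Nat.add_mul_mod_self_left, Nat.mod_eq_of_lt hm]
  have h2 : (Z &&& (m + 2 ^ w * M)) / 2 ^ w = Z / 2 ^ w &&& M := by
    rw [Nat.and_div_two_pow, Nat.add_mul_div_left _ _ (by positivity), Nat.div_eq_of_lt hm,
      zero_add]
  rw [← h1, ← h2, Nat.mod_add_div]

/-- After the shift, slot i holds e_i / 2^s in its low w - s bits, and above them the low s bits of
e_(i+1). The mask removes the latter. The induction strips off the lowest digit. -/
theorem land_digitMask {w s : ℕ} (hs : s ≤ w) (e : ℕ → ℕ) (he : ∀ i, e i < 2 ^ w) (L M : ℕ)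
    (hLM : L ≤ M) :
    ((∑ i ∈ Finset.range L, e i * (2 ^ w) ^ i) >>> s) &&&
        (∑ i ∈ Finset.range M, (2 ^ (w - s) - 1) * (2 ^ w) ^ i) =
      ∑ i ∈ Finset.range L, e i / 2 ^ s * (2 ^ w) ^ i := by
  induction L generalizing e M with
  | zero => simp
  | succ L ih =>
    obtain ⟨M, rfl⟩ : ∃ M', M = M' + 1 := ⟨M - 1, by omega⟩
    have split : ∀ (c : ℕ → ℕ) (k : ℕ), ∑ i ∈ Finset.range (k + 1), c i * (2 ^ w) ^ i =
        c 0 + 2 ^ w * ∑ i ∈ Finset.range k, c (i + 1) * (2 ^ w) ^ i := fun c k => by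
      rw [Finset.sum_range_succ', Finset.mul_sum, add_comm]
      congr 1
      · simp
      · exact Finset.sum_congr rfl fun i _ => by rw [pow_succ]; ring
    have hws : 2 ^ w = 2 ^ s * 2 ^ (w - s) := by rw [← pow_add]; congr 1; omega
    have hmlt : 2 ^ (w - s) - 1 < 2 ^ w := by
      have : 2 ^ (w - s) ≤ 2 ^ w := Nat.pow_le_pow_right (by norm_num) (by omega)
      have : 0 < 2 ^ (w - s) := by positivity
      omega
    rw [split (fun _ => 2 ^ (w - s) - 1) M, split (fun i => e i / 2 ^ s), split e,
      Nat.shiftRight_eq_div_pow, land_add_two_pow_mul _ _ _ hmlt,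
      ← ih (fun i => e (i + 1)) (fun i => he _) M (by omega), Nat.shiftRight_eq_div_pow]
    set T := ∑ i ∈ Finset.range L, e (i + 1) * (2 ^ w) ^ i
    congr 1
    · rw [Nat.and_two_pow_sub_one_eq_mod, Nat.mod_mod_of_dvd _ (pow_dvd_pow 2 (by omega)), hws,
        mul_assoc, Nat.add_mul_div_left _ _ (by positivity), Nat.add_mul_mod_self_left,
        Nat.mod_eq_of_lt]
      rw [Nat.div_lt_iff_lt_mul (by positivity), mul_comm, ← hws]
      exact he 0
    · rw [Nat.div_div_eq_div_mul, mul_comm (2 ^ s), ← Nat.div_div_eq_div_mul,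
        Nat.add_mul_div_left _ _ (by positivity), Nat.div_eq_of_lt (he 0), zero_add]

/-- Put μ = ⌊2^s / p⌋ + 1. Then p μ lies between 2^s and 2^s + p, so c μ / 2^s exceeds c / p by at
most c / 2^s < 1 / p, which is too little to reach the next integer. -/
theorem mul_reciprocal_div {p s C c : ℕ} (hp : 0 < p) (hC : C * p ≤ 2 ^ s) (hc : c < C) :
    c * (2 ^ s / p + 1) / 2 ^ s = c / p := by
  set μ := 2 ^ s / p + 1 with hμ
  have h1 : 2 ^ s ≤ p * μ := by
    have := Nat.div_add_mod (2 ^ s) p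
    have := Nat.mod_lt (2 ^ s) hp
    rw [hμ, mul_add, mul_one]; omega
  have h2 : p * μ ≤ 2 ^ s + p := by
    have := Nat.mul_div_le (2 ^ s) p
    rw [hμ, mul_add, mul_one]; omega
  have hS : 0 < 2 ^ s := by positivity
  have hc' := Nat.div_add_mod c p
  have hr := Nat.mod_lt c hp
  set q := c / p
  set r := c % p
  refine Nat.div_eq_of_lt_le ?_ ?_
  · calc q * 2 ^ s ≤ q * (p * μ) := Nat.mul_le_mul_left _ h1
      _ = (p * q) * μ := by ring
      _ ≤ c * μ := Nat.mul_le_mul_right _ (by omega)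
  · have h3 : p * (c * μ) < p * ((q + 1) * 2 ^ s) := by
      calc p * (c * μ) = c * (p * μ) := by ring
        _ ≤ c * (2 ^ s + p) := Nat.mul_le_mul_left _ h2
        _ = c * 2 ^ s + c * p := by ring
        _ < c * 2 ^ s + 2 ^ s := by
            have : c * p < C * p := Nat.mul_lt_mul_of_pos_right hc hp
            omega
        _ = (c + 1) * 2 ^ s := by ring
        _ ≤ (p * q + p) * 2 ^ s := Nat.mul_le_mul_right _ (by omega)
        _ = p * ((q + 1) * 2 ^ s) := by ring
    exact lt_of_mul_lt_mul_left h3 (Nat.zero_le p)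

-- One multiplication by the reciprocal, one shift and one mask produce all quotients c_i / p
-- simultaneously. Subtracting p times the result leaves the remainders c_i % p, with no borrow
-- between digits.
open Polynomial in
theorem Packs.packedMod {p w s C L M N : ℕ} (hp : 0 < p) (hs : s ≤ w) (hw : 0 < w)
    (hC : (C + 1) * p ≤ 2 ^ s) (hCw : C * (2 ^ s / p + 1) < 2 ^ w) {P : (ZMod p)[X]} (hLM : L ≤ M)
    (h : Packs w L C N P) :
    Packs w L (p - 1) (packedMod s (2 ^ s / p + 1) p (digitMask w s M) N) P := by
  obtain ⟨c, h1, h2, h3, h4⟩ := h.exists_digits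
  have hq : (N * (2 ^ s / p + 1)) >>> s &&& digitMask w s M =
      ∑ i ∈ Finset.range L, c i / p * (2 ^ w) ^ i := by
    have e : N * (2 ^ s / p + 1) =
        ∑ i ∈ Finset.range L, c i * (2 ^ s / p + 1) * (2 ^ w) ^ i := by
      rw [h3, Finset.sum_mul]
      exact Finset.sum_congr rfl fun i _ => by ring
    rw [e, digitMask_eq hw, land_digitMask hs (fun i => c i * (2 ^ s / p + 1))
      (fun i => (Nat.mul_le_mul_right _ (h1 i)).trans_lt hCw) L M hLM]
    exact Finset.sum_congr rfl fun i _ => by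
      rw [mul_reciprocal_div hp hC (Nat.lt_succ_of_le (h1 i))]
  refine of_digits (fun i => c i % p) (fun i => Nat.le_sub_one_of_lt (Nat.mod_lt _ hp))
    (fun i hi => by simp [h2 i hi]) ?_ (fun i => by rw [h4, ZMod.natCast_mod])
  change N - p * ((N * (2 ^ s / p + 1)) >>> s &&& digitMask w s M) = _
  rw [hq, Nat.sub_eq_iff_eq_add, h3, Finset.mul_sum, ← Finset.sum_add_distrib]
  · refine Finset.sum_congr rfl fun i _ => ?_
    conv_lhs => rw [← Nat.mod_add_div (c i) p]
    ring
  · rw [h3, Finset.mul_sum]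
    refine Finset.sum_le_sum fun i _ => ?_
    rw [← mul_assoc]
    exact Nat.mul_le_mul_right _ (Nat.mul_div_le _ _)

/-! ### Algebra of the test: Rabin's criterion, Frobenius, Barrett division -/

-- An irreducible factor π of f divides X^(p^n) - X, so its degree divides n. If the degree were a
-- proper divisor, it would divide some e in `E`; then π would divide X^(p^e) - X, hence `U`, hence
-- the nonzero constant. So π has degree n and is f up to a unit. It is enough to know `U` modulo f.
open Polynomial in
theorem irreducible_of_rabin {p n : ℕ} [Fact p.Prime] {f U : (ZMod p)[X]} (hf : f.Monic)
    (hn : f.natDegree = n) (hn0 : 0 < n) (h1 : f ∣ X ^ p ^ n - X) (E : List ℕ)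
    (hE : ∀ d, d ∣ n → d < n → ∃ e ∈ E, d ∣ e)
    (hU : f ∣ U - (E.map fun e => (X ^ p ^ e - X : (ZMod p)[X])).prod) {c : ZMod p} (hc : c ≠ 0)
    (hmem : C c ∈ Ideal.span {f, U}) : Irreducible f := by
  have hdeg : ¬ IsUnit f := fun hu => by
    have := natDegree_eq_zero_of_isUnit hu
    omega
  obtain ⟨π, hπ, hπf⟩ := WfDvdMonoid.exists_irreducible_factor hdeg hf.ne_zero
  have hcard : Nat.card (ZMod p) = p := Nat.card_zmod p
  have hπn : π.natDegree ∣ n := by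
    apply hπ.natDegree_dvd_of_dvd_X_pow_card_pow_sub_X
    rw [hcard]
    exact hπf.trans h1
  rcases (Nat.le_of_dvd hn0 hπn).lt_or_eq with hlt | heq
  · exfalso
    obtain ⟨e, he, hde⟩ := hE _ hπn hlt
    have hπe : π ∣ X ^ p ^ e - X := by
      have := hπ.natDegree_dvd_iff_dvd_X_pow_card_pow_sub_X.1 hde
      rwa [hcard] at this
    have hπU : π ∣ U := by
      have h2 : π ∣ (E.map fun e => (X ^ p ^ e - X : (ZMod p)[X])).prod :=
        hπe.trans (List.dvd_prod (List.mem_map_of_mem (f := fun e => (X ^ p ^ e - X : (ZMod p)[X])) he))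
      have h3 := dvd_add (hπf.trans hU) h2
      rwa [sub_add_cancel] at h3
    obtain ⟨a, b, hab⟩ := Ideal.mem_span_pair.1 hmem
    have : π ∣ C c := by
      rw [← hab]
      exact dvd_add (hπf.mul_left a) (hπU.mul_left b)
    exact hπ.not_isUnit (isUnit_of_dvd_unit this (isUnit_C.2 hc.isUnit))
  · obtain ⟨q, rfl⟩ := hπf
    have hq : q ≠ 0 := fun h => hf.ne_zero (by simp [h])
    rw [natDegree_mul hπ.ne_zero hq] at hn
    have hq0 : q.natDegree = 0 := by omega
    have hqu : IsUnit q := by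
      rw [eq_C_of_natDegree_eq_zero hq0] at hq ⊢
      exact isUnit_C.2 (IsUnit.mk0 _ fun h => hq (by rw [h, C_0]))
    exact (irreducible_mul_isUnit hqu).2 hπ

-- Coefficients in 𝔽_p are fixed by Frobenius. Thus if G ≡ X^(p^i) and H ≡ X^(p^j) modulo f, then
-- G(H) ≡ X^(p^(i+j)).
open Polynomial in
theorem aeval_pow_card_pow {p : ℕ} [Fact p.Prime] {A : Type*} [CommRing A] [Algebra (ZMod p) A]
    (P : (ZMod p)[X]) (z : A) (j : ℕ) : aeval (z ^ p ^ j) P = aeval z P ^ p ^ j := by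
  induction j with
  | zero => simp
  | succ j ih =>
    rw [pow_succ p j, pow_mul, pow_mul, ← ih, ← map_pow, ← ZMod.expand_card, expand_aeval]

open Polynomial in
theorem coeff_mul_eq_zero {R : Type*} [CommRing R] {P Q : R[X]} {a b i : ℕ}
    (hP : ∀ i, a ≤ i → P.coeff i = 0) (hQ : ∀ i, b ≤ i → Q.coeff i = 0) (hi : a + b ≤ i + 1) :
    (P * Q).coeff i = 0 := by
  rw [coeff_mul]
  refine Finset.sum_eq_zero fun x hx => ?_
  have := Finset.HasAntidiagonal.mem_antidiagonal.1 hx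
  rcases le_or_gt a x.1 with h | h
  · rw [hP _ h, zero_mul]
  · rw [hQ _ (by omega), mul_zero]

open Polynomial in
theorem exists_eq_X_pow_mul_add {R : Type*} [CommRing R] {S T : R[X]} {k : ℕ}
    (h : ∀ i, T.coeff i = S.coeff (k + i)) :
    ∃ r : R[X], S = X ^ k * T + r ∧ ∀ i, k ≤ i → r.coeff i = 0 := by
  refine ⟨S - X ^ k * T, by ring, fun i hi => ?_⟩
  rw [coeff_sub, coeff_X_pow_mul', if_pos hi, h, Nat.add_sub_cancel' hi, sub_self]

open Polynomial in
/-- If `J` is the quotient of `X ^ (2 n - 1)` by `f`, then the quotient of `S` by `f` can be read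
off from the top coefficients of `S` and `J`. -/
theorem coeff_sub_barrett_eq_zero {R : Type*} [CommRing R] {n : ℕ} (hn : 2 ≤ n)
    {f J e S T Q : R[X]} (hf : ∀ i, n + 1 ≤ i → f.coeff i = 0)
    (hJ : f * J = X ^ (2 * n - 1) + e) (he : ∀ i, n ≤ i → e.coeff i = 0)
    (hS : ∀ i, 2 * n - 1 ≤ i → S.coeff i = 0) (hT : ∀ i, T.coeff i = S.coeff (n + i))
    (hQ : ∀ i, Q.coeff i = (T * J).coeff (n - 1 + i)) (i : ℕ) (hi : n ≤ i) :
    (S - Q * f).coeff i = 0 := by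
  obtain ⟨s0, hs0, hs0'⟩ := exists_eq_X_pow_mul_add hT
  obtain ⟨s1, hs1, hs1'⟩ := exists_eq_X_pow_mul_add hQ
  have hT0 : ∀ i, n - 1 ≤ i → T.coeff i = 0 := fun i hi => by rw [hT, hS _ (by omega)]
  -- On the right, s0 and e have degree below n, T and s1 degree below n - 1, and f degree at most
  -- n. All terms therefore have degree below 2n - 1, so the candidate remainder has degree below n
  -- and needs no correction step.
  have key : X ^ (n - 1) * (S - Q * f) = X ^ (n - 1) * s0 - T * e + s1 * f := by
    have e1 : X ^ (n - 1) * X ^ n = (X ^ (2 * n - 1) : R[X]) := by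
      rw [← pow_add]; congr 1; omega
    calc X ^ (n - 1) * (S - Q * f) = X ^ (n - 1) * S - (X ^ (n - 1) * Q) * f := by ring
      _ = X ^ (n - 1) * (X ^ n * T + s0) - (T * J - s1) * f := by
          rw [← hs0, hs1]; ring
      _ = (X ^ (n - 1) * X ^ n) * T + X ^ (n - 1) * s0 - T * (f * J) + s1 * f := by ring
      _ = _ := by rw [e1, hJ]; ring
  have hc := congrArg (fun P => P.coeff (n - 1 + i)) key
  rw [coeff_add, coeff_sub, coeff_X_pow_mul', coeff_X_pow_mul'] at hc
  rw [if_pos (by omega), if_pos (by omega), Nat.add_sub_cancel_left, hs0' i hi, coeff_mul_eq_zero hT0 he (by omega), coeff_mul_eq_zero hs1' hf (by omega)] at hc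
  rw [hc]
  simp

/-! ### Packed arithmetic modulo f -/

open Polynomial in
/-- `N` packs a representative of `z` of degree less than `n`. -/
def PacksMod {p : ℕ} (w n : ℕ) (f : (ZMod p)[X]) (N : ℕ) (z : AdjoinRoot f) : Prop :=
  ∃ P : (ZMod p)[X], Packs w n (p - 1) N P ∧ AdjoinRoot.mk f P = z

/-- Product modulo `f`, where `F` packs `-f` and `I` packs the quotient of `X ^ (2 n - 1)` by `f`. -/
def packedMulMod (rd : ℕ → ℕ) (wn wn1 I F N M : ℕ) : ℕ :=
  (fun c => rd (Nat.add c
    (Nat.mul (rd (Nat.shiftRight (Nat.mul (Nat.shiftRight c wn) I) wn1)) F))) (rd (Nat.mul N M))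

/-- The list `[b, b * h, …, b * h ^ k]`. -/
noncomputable def powerList (mm : ℕ → ℕ → ℕ) (h k : ℕ) : ℕ → List ℕ :=
  Nat.rec (fun b => [b]) (fun _ ih b => b :: ih (mm h b)) k

/-- The linear combination of the entries of `l` with the lowest digits of `G` as coefficients. -/
noncomputable def digitCombination (w dm : ℕ) (l : List ℕ) : ℕ → ℕ :=
  List.rec (fun _ => 0)
    (fun b _ ih G => Nat.add (Nat.mul (Nat.land G dm) b) (ih (Nat.shiftRight G w))) l

/-- Horner evaluation of `G`, in `k` blocks of digits. -/
noncomputable def hornerBlocks (rd : ℕ → ℕ) (mm : ℕ → ℕ → ℕ) (w dm wm : ℕ) (l : List ℕ)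
    (hm k : ℕ) : ℕ → ℕ :=
  Nat.rec (fun _ => 0) (fun _ ih G =>
    rd (Nat.add (digitCombination w dm l G) (mm hm (ih (Nat.shiftRight G wm))))) k

/-- The composition `G ∘ H` modulo `f`. -/
noncomputable def packedComp (rd : ℕ → ℕ) (mm : ℕ → ℕ → ℕ) (w dm m k G H : ℕ) : ℕ :=
  (fun l => hornerBlocks rd mm w dm (Nat.mul w (Nat.succ m)) l (mm H (l.getLastD 0)) k G)
    (powerList mm H m 1)

/-- The power `X ^ e` modulo `f`, for `e < 2 ^ fuel`. -/
noncomputable def packedXPow (mm : ℕ → ℕ → ℕ) (x fuel : ℕ) : ℕ → ℕ :=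
  Nat.rec (fun _ => 1) (fun _ ih e => (fun r =>
    cond (Nat.beq (Nat.land e 1) 1) (mm x (mm r r)) (mm r r)) (ih (Nat.shiftRight e 1))) fuel

/-- Division of `X ^ (n + k)` by `f`, starting from the remainder `r` and the quotient `I` for
`X ^ n`. -/
noncomputable def packedInverse (rd : ℕ → ℕ) (w wn1 F k : ℕ) : ℕ → ℕ → ℕ :=
  Nat.rec (fun _ I => I) (fun _ ih r I => (fun t =>
    ih (rd (Nat.add (Nat.shiftLeft r w) (Nat.mul t F))) (Nat.add t (Nat.shiftLeft I w)))
      (Nat.shiftRight r wn1)) k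

/-- The Euclidean algorithm, without divisions, on polynomials `a`, `b` of degree at most
`da`, `db`: does it end in a nonzero constant? -/
noncomputable def packedCoprime (rd : ℕ → ℕ) (w p fuel : ℕ) : ℕ → ℕ → ℕ → ℕ → Bool :=
  Nat.rec (fun _ _ _ _ => false) (fun _ ih a da b db =>
    cond (Nat.beq db 0) (Nat.ble 1 b)
      (cond (Nat.ble db da)
        ((fun lb => cond (Nat.beq lb 0) (ih a da b (Nat.sub db 1))
          (ih (rd (Nat.add (Nat.mul lb a)
              (Nat.mul (Nat.sub p (Nat.shiftRight a (Nat.mul w da)))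
                (Nat.shiftLeft b (Nat.mul w (Nat.sub da db))))))
            (Nat.sub da 1) b db)) (Nat.shiftRight b (Nat.mul w db)))
        (ih b db a da))) fuel

/-- What is used of the coefficientwise reduction `rd`, with room for the arithmetic modulo a
polynomial of degree `n`. -/
def IsPackedMod (p w n : ℕ) (rd : ℕ → ℕ) : Prop :=
  (n + 30) * p * p < 2 ^ w ∧ ∀ (L N : ℕ) (P : Polynomial (ZMod p)), L ≤ 2 * n →
    Packs w L ((n + 30) * p * p) N P → Packs w L (p - 1) (rd N) P

theorem IsPackedMod.lt {p w n : ℕ} [hp : Fact p.Prime] {rd : ℕ → ℕ} (h : IsPackedMod p w n rd) :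
    p - 1 < 2 ^ w := by
  refine lt_of_le_of_lt ?_ h.1
  have := hp.out.pos
  nlinarith [Nat.sub_le p 1, Nat.mul_le_mul this this, Nat.zero_le (n * p * p)]

theorem IsPackedMod.packs {p w n : ℕ} {rd : ℕ → ℕ} (h : IsPackedMod p w n rd)
    {L b N : ℕ} {P : Polynomial (ZMod p)} (hL : L ≤ 2 * n) (hb : b ≤ (n + 30) * p * p)
    (hN : Packs w L b N P) : Packs w L (p - 1) (rd N) P :=
  h.2 L N P hL (hN.mono le_rfl hb)

/-- Budget for unreduced coefficients: `a` counts products of two reduced digits, and `k * p * p`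
covers summands added on top. The 30 leaves room for block combinations of up to 29 terms. -/
theorem mul_sq_sub_one_add_le {a k p n : ℕ} (h : a + k ≤ n + 30) :
    a * ((p - 1) * (p - 1)) + k * p * p ≤ (n + 30) * p * p := by
  have h1 : (p - 1) * (p - 1) ≤ p * p := Nat.mul_le_mul (Nat.sub_le p 1) (Nat.sub_le p 1)
  calc a * ((p - 1) * (p - 1)) + k * p * p ≤ a * (p * p) + k * p * p :=
        Nat.add_le_add_right (Nat.mul_le_mul_left _ h1) _
    _ = (a + k) * (p * p) := by ring
    _ ≤ (n + 30) * (p * p) := Nat.mul_le_mul_right _ h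
    _ = _ := by ring

section

variable {p w n : ℕ} [hp : Fact p.Prime] {rd : ℕ → ℕ} {f : Polynomial (ZMod p)}

theorem le_mul_self_prime (p : ℕ) [hp : Fact p.Prime] : p ≤ 1 * p * p := by
  have := hp.out.pos
  nlinarith

open Polynomial in
theorem PacksMod.mulMod (hrd : IsPackedMod p w n rd) (hn : 2 ≤ n) {F I : ℕ} {J e : (ZMod p)[X]}
    (hf : ∀ i, n + 1 ≤ i → f.coeff i = 0) (hF : Packs w (n + 1) (p - 1) F (-f))
    (hI : Packs w n (p - 1) I J) (hJ : f * J = X ^ (2 * n - 1) + e)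
    (he : ∀ i, n ≤ i → e.coeff i = 0) {N M : ℕ} {y z : AdjoinRoot f} (hN : PacksMod w n f N y)
    (hM : PacksMod w n f M z) :
    PacksMod w n f (packedMulMod rd (w * n) (w * (n - 1)) I F N M) (y * z) := by
  obtain ⟨P, hP, rfl⟩ := hN
  obtain ⟨Q, hQ, rfl⟩ := hM
  have hc := hrd.packs (by omega) ((Nat.le_add_right _ _).trans
    (mul_sq_sub_one_add_le (k := 0) (by omega))) (hP.mul hQ)
  set c := rd (N * M) with hcdef
  obtain ⟨T, hT, hTc⟩ := hc.shiftRight n hrd.lt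
  have hTJ := (hT.mono (show n + n - 1 - n ≤ n - 1 by omega) le_rfl).mul hI
  have hbound : (n - 1) * ((p - 1) * (p - 1)) ≤ (n + 30) * p * p :=
    (Nat.le_add_right _ _).trans (mul_sq_sub_one_add_le (k := 0) (by omega))
  obtain ⟨R, hR, hRc⟩ := hTJ.shiftRight (n - 1) (hbound.trans_lt hrd.1)
  have hR' := hrd.packs (by omega) hbound (hR.mono (show _ ≤ n - 1 by omega) le_rfl)
  have hRF := hR'.mul hF
  have hsum := (hc.mono (show n + n - 1 ≤ 2 * n by omega) le_rfl).add
    (hRF.mono (show _ ≤ 2 * n by omega) le_rfl)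
  have hfin := hrd.packs le_rfl ((add_comm _ _).trans_le ((Nat.add_le_add_left
    ((Nat.sub_le p 1).trans (le_mul_self_prime p)) _).trans
    (mul_sq_sub_one_add_le (k := 1) (by omega)))) hsum
  obtain ⟨cP, _, hcP, _, hcP'⟩ := hP.exists_digits
  obtain ⟨cQ, _, hcQ, _, hcQ'⟩ := hQ.exists_digits
  -- A priori the sum has up to 2n digits. The Barrett identity makes the coefficients from n on
  -- vanish modulo p, hence also the reduced digits.
  refine ⟨P * Q + R * -f, hfin.of_coeff_eq_zero fun i hi => ?_, ?_⟩
  · rw [mul_neg, ← sub_eq_add_neg]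
    refine coeff_sub_barrett_eq_zero hn hf hJ he (fun i hi => ?_) hTc hRc i hi
    exact coeff_mul_eq_zero (a := n) (b := n) (fun i hi => by rw [hcP', hcP i hi, Nat.cast_zero])
      (fun i hi => by rw [hcQ', hcQ i hi, Nat.cast_zero]) (by omega)
  · simp

-- Long division with the invariant f J + R = X^(n-1+j). Each step multiplies by X and subtracts t
-- f, where t is the coefficient of X^(n-1) in R; since f is monic, the new remainder again has
-- degree below n. The digit t is appended at the bottom of the quotient.
open Polynomial in
theorem packedInverse_spec (hrd : IsPackedMod p w n rd) (hn : 2 ≤ n)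
    (hf : f.Monic) (hfn : f.natDegree = n) {F : ℕ} (hF : Packs w (n + 1) (p - 1) F (-f))
    (k j : ℕ) (hkj : k + j ≤ n) (r I : ℕ) (R J : (ZMod p)[X]) (hr : Packs w n (p - 1) r R)
    (hI : Packs w j (p - 1) I J) (hJ : f * J + R = X ^ (n - 1 + j)) :
    ∃ J' e : (ZMod p)[X],
      Packs w (k + j) (p - 1) (packedInverse rd w (w * (n - 1)) F k r I) J' ∧
      f * J' = X ^ (n - 1 + (k + j)) + e ∧ ∀ i, n ≤ i → e.coeff i = 0 := by
  induction k generalizing j r I R J with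
  | zero =>
    refine ⟨J, -R, by rw [zero_add]; exact hI, ?_, fun i hi => ?_⟩
    · rw [zero_add, ← hJ]; ring
    · obtain ⟨c, _, hc, _, hc'⟩ := hr.exists_digits
      rw [coeff_neg, hc', hc i hi]; simp
  | succ k ih =>
    obtain ⟨ht1, ht2⟩ := (hr.mono (show n ≤ n - 1 + 1 by omega) le_rfl).top_digit hrd.lt
    have hs := (hr.shiftLeft 1).add (hF.smul ht1)
    have hs' := hrd.packs (by omega) ((show _ = 1 * ((p - 1) * (p - 1)) + (p - 1) by
      ring).trans_le ((Nat.add_le_add_left ((Nat.sub_le p 1).trans (le_mul_self_prime p)) _).trans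
      (mul_sq_sub_one_add_le (k := 1) (by omega)))) hs
    have hlead : f.coeff n = 1 := by rw [← hfn]; exact hf
    obtain ⟨c, _, hc, _, hc'⟩ := hr.exists_digits
    have hnew : Packs w n (p - 1) (rd (r <<< (w * 1) + r >>> (w * (n - 1)) * F))
        (X ^ 1 * R + C ((r >>> (w * (n - 1)) : ℕ) : ZMod p) * -f) := by
      refine hs'.of_coeff_eq_zero fun i hi => ?_
      rw [pow_one, coeff_add, coeff_C_mul, coeff_neg]
      obtain ⟨i, rfl⟩ : ∃ i', i = i' + 1 := ⟨i - 1, by omega⟩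
      rw [coeff_X_mul]
      rcases hi.lt_or_eq with h | h
      · rw [hc', hc i (by omega), coeff_eq_zero_of_natDegree_lt (by omega)]; simp
      · rw [← h, hlead, ht2, show i = n - 1 by omega]; ring
    have := ih (j + 1) (by omega) _ _ _ _ hnew (hI.cons ht1) (by
      rw [show n - 1 + (j + 1) = n - 1 + j + 1 by omega, pow_succ]
      linear_combination X * hJ)
    rw [mul_one] at this
    rw [show k + 1 + j = k + (j + 1) by omega]
    exact this

end

/-- `mm` multiplies packed residues modulo `f`. -/
def IsPackedMulMod {p : ℕ} (w n : ℕ) (f : Polynomial (ZMod p)) (mm : ℕ → ℕ → ℕ) : Prop :=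
  ∀ (N M : ℕ) (y z : AdjoinRoot f), PacksMod w n f N y → PacksMod w n f M z →
    PacksMod w n f (mm N M) (y * z)

/-- The entries of `l` pack `b, b * z, b * z ^ 2, …`. -/
def IsPowerList {p : ℕ} (w n : ℕ) (f : Polynomial (ZMod p)) (z : AdjoinRoot f) :
    List ℕ → AdjoinRoot f → Prop
  | [], _ => True
  | a :: l, b => PacksMod w n f a b ∧ IsPowerList w n f z l (b * z)

theorem isPowerList_powerList {p w n : ℕ} {mm : ℕ → ℕ → ℕ} {f : Polynomial (ZMod p)}
    (hmm : IsPackedMulMod w n f mm) {h : ℕ} {z : AdjoinRoot f}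
    (hz : PacksMod w n f h z) (k a : ℕ) (b : AdjoinRoot f) (ha : PacksMod w n f a b) :
    IsPowerList w n f z (powerList mm h k a) b ∧ (powerList mm h k a).length = k + 1 ∧
      PacksMod w n f ((powerList mm h k a).getLastD 0) (b * z ^ k) := by
  induction k generalizing a b with
  | zero => exact ⟨⟨ha, trivial⟩, rfl, by rw [pow_zero, mul_one]; exact ha⟩
  | succ k ih =>
    have hba : PacksMod w n f (mm h a) (b * z) := by rw [mul_comm]; exact hmm _ _ _ _ hz ha
    obtain ⟨h1, h2, h3⟩ := ih (mm h a) (b * z) hba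
    have e : powerList mm h (k + 1) a = a :: powerList mm h k (mm h a) := rfl
    rw [e]
    refine ⟨⟨ha, h1⟩, by rw [List.length_cons, h2], ?_⟩
    have hne : powerList mm h k (mm h a) ≠ [] := fun h0 => by simp [h0] at h2
    have : (a :: powerList mm h k (mm h a)).getLastD 0 =
        (powerList mm h k (mm h a)).getLastD 0 := by
      obtain ⟨c, l, hl⟩ := List.exists_cons_of_ne_nil hne
      simp [hl]
    rw [this, pow_succ', ← mul_assoc]
    exact h3

section

variable {p w n : ℕ} [hp : Fact p.Prime] {rd : ℕ → ℕ} {mm : ℕ → ℕ → ℕ} {f : Polynomial (ZMod p)}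

open Polynomial in
theorem digitCombination_spec (hw : p - 1 < 2 ^ w) {z : AdjoinRoot f} (l : List ℕ)
    (b : AdjoinRoot f) (hl : IsPowerList w n f z l b) (L G : ℕ) (P : (ZMod p)[X])
    (hG : Packs w L (p - 1) G P) :
    ∃ S : (ZMod p)[X],
      Packs w n (l.length * ((p - 1) * (p - 1))) (digitCombination w (2 ^ w - 1) l G) S ∧
      AdjoinRoot.mk f S =
        b * ∑ i ∈ Finset.range l.length, algebraMap (ZMod p) _ (P.coeff i) * z ^ i := by
  induction l generalizing b L G P with
  | nil => exact ⟨0, Packs.zero _ _, by simp⟩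
  | cons a l ih =>
    obtain ⟨⟨A, hA, hAb⟩, hl'⟩ := hl
    obtain ⟨P', hP', hPc⟩ := hG.shiftRight 1 hw
    rw [mul_one] at hP'
    obtain ⟨S, hS, hSv⟩ := ih (b * z) hl' _ _ _ hP'
    obtain ⟨h1, h2⟩ := hG.land_mask hw
    have := (hA.smul h1).add hS
    -- No reduction takes place inside a combination: every list entry adds at most (p - 1)² to each
    -- coefficient.
    refine ⟨_, this.mono le_rfl (by rw [List.length_cons]; exact le_of_eq (by ring)), ?_⟩
    rw [map_add, map_mul, hAb, hSv, h2, List.length_cons, Finset.sum_range_succ', pow_zero, mul_one,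
      mul_add, add_comm, mul_assoc b z, Finset.mul_sum]
    congr 1
    · congr 1
      exact Finset.sum_congr rfl fun i _ => by rw [hPc, add_comm 1 i]; ring
    · rw [mul_comm]; rfl

-- Baby steps and giant steps: the coefficients are cut into blocks of `l.length`. A block is a
-- linear combination of the stored powers of z, and passing to the next block costs one
-- multiplication by z ^ `l.length`. The bound 29 lets a combination plus a reduced summand be
-- reduced only once.
open Polynomial in
theorem hornerBlocks_spec (hrd : IsPackedMod p w n rd) (hmm : IsPackedMulMod w n f mm)
    {z : AdjoinRoot f} {l : List ℕ} (hl : IsPowerList w n f z l 1) (hlen : l.length ≤ 29) {hm : ℕ}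
    (hhm : PacksMod w n f hm (z ^ l.length)) (k L G : ℕ) (P : (ZMod p)[X])
    (hG : Packs w L (p - 1) G P) :
    PacksMod w n f (hornerBlocks rd mm w (2 ^ w - 1) (w * l.length) l hm k G)
      (∑ i ∈ Finset.range (k * l.length), algebraMap (ZMod p) _ (P.coeff i) * z ^ i) := by
  induction k generalizing L G P with
  | zero => exact ⟨0, Packs.zero _ _, by simp⟩
  | succ k ih =>
    obtain ⟨P', hP', hPc⟩ := hG.shiftRight l.length hrd.lt
    obtain ⟨A, hA, hAv⟩ := hmm _ _ _ _ hhm (ih _ _ _ hP')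
    obtain ⟨S, hS, hSv⟩ := digitCombination_spec hrd.lt l 1 hl _ _ _ hG
    have hsum := hrd.packs (by omega) ((Nat.add_le_add_left ((Nat.sub_le p 1).trans
      (le_mul_self_prime p)) _).trans (mul_sq_sub_one_add_le (k := 1) (by omega))) (hS.add hA)
    refine ⟨_, hsum, ?_⟩
    rw [map_add, hSv, hAv, one_mul, Nat.succ_mul, add_comm (k * l.length), Finset.sum_range_add,
      Finset.mul_sum]
    congr 1
    exact Finset.sum_congr rfl fun i _ => by rw [hPc, pow_add]; ring

-- By `aeval_pow_card_pow`, composing Frobenius powers of the root adds their exponents. This is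
-- what makes an addition chain for n usable.
open Polynomial in
theorem packedComp_spec (hrd : IsPackedMod p w n rd) (hmm : IsPackedMulMod w n f mm)
    (h1 : PacksMod w n f 1 1) {m k : ℕ} (hm : m ≤ 28) (hk : n ≤ k * (m + 1)) {G H i j : ℕ}
    (hG : PacksMod w n f G (AdjoinRoot.root f ^ p ^ i))
    (hH : PacksMod w n f H (AdjoinRoot.root f ^ p ^ j)) :
    PacksMod w n f (packedComp rd mm w (2 ^ w - 1) m k G H)
      (AdjoinRoot.root f ^ p ^ (i + j)) := by
  obtain ⟨e1, e2, e3⟩ := isPowerList_powerList hmm hH m 1 1 h1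
  obtain ⟨P, hP, hPv⟩ := hG
  have hlast := hmm _ _ _ _ hH e3
  rw [one_mul, ← pow_succ', ← e2] at hlast
  have := hornerBlocks_spec hrd hmm e1 (by omega) hlast k _ _ _ hP
  rw [e2] at this
  have hval : ∑ t ∈ Finset.range (k * (m + 1)), algebraMap (ZMod p) (AdjoinRoot f) (P.coeff t) *
      (AdjoinRoot.root f ^ p ^ j) ^ t = AdjoinRoot.root f ^ p ^ (i + j) := by
    obtain ⟨c, _, hc, _, hc'⟩ := hP.exists_digits
    have hz : ∀ t, k * (m + 1) ≤ t → P.coeff t = 0 := fun t ht => by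
      rw [hc', hc t (hk.trans ht), Nat.cast_zero]
    have haev : aeval (AdjoinRoot.root f ^ p ^ j) P = AdjoinRoot.root f ^ p ^ (i + j) := by
      rw [aeval_pow_card_pow, AdjoinRoot.aeval_eq, hPv, ← pow_mul, ← pow_add]
    rw [← haev]
    by_cases hP0 : P = 0
    · simp [hP0]
    · rw [aeval_eq_sum_range' (n := k * (m + 1))]
      · exact Finset.sum_congr rfl fun t _ => by rw [Algebra.smul_def]
      · by_contra hlt
        exact hP0 (leadingCoeff_eq_zero.1 (hz _ (not_lt.1 hlt)))
  rw [hval] at this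
  exact this

open Polynomial in
theorem packsMod_one (hn : 1 ≤ n) : PacksMod w n f 1 1 := by
  have := hp.out.two_le
  refine ⟨C ((1 : ℕ) : ZMod p), Packs.const (by omega) (by omega), by simp⟩

open Polynomial in
theorem packs_X {L : ℕ} (hL : 2 ≤ L) : Packs w L (p - 1) (2 ^ w) (X : (ZMod p)[X]) := by
  have := hp.out.two_le
  have h := (Packs.const (p := p) (w := w) (L := 1) (b := p - 1) (d := 1) (by omega)
    (by omega)).shiftLeft 1
  rw [mul_one, Nat.shiftLeft_eq, one_mul] at h
  simpa using h.mono (show 1 + 1 ≤ L by omega) le_rfl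

open Polynomial in
theorem packsMod_root (hn : 2 ≤ n) : PacksMod w n f (2 ^ w) (AdjoinRoot.root f) :=
  ⟨X, packs_X hn, AdjoinRoot.mk_X⟩

theorem packedXPow_spec (hmm : IsPackedMulMod w n f mm) (hn : 2 ≤ n) (fuel e : ℕ)
    (he : e < 2 ^ fuel) :
    PacksMod w n f (packedXPow mm (2 ^ w) fuel e) (AdjoinRoot.root f ^ e) := by
  induction fuel generalizing e with
  | zero =>
    obtain rfl : e = 0 := by simpa using he
    rw [pow_zero]
    exact packsMod_one (by omega)
  | succ fuel ih =>
    have hlt : e >>> 1 < 2 ^ fuel := by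
      rw [Nat.shiftRight_one]
      rw [pow_succ] at he
      omega
    have h := ih _ hlt
    have h2 := hmm _ _ _ _ h h
    rw [← pow_add] at h2
    have hs := Nat.shiftRight_one e
    change PacksMod w n f (cond (Nat.beq (e &&& 1) 1)
      (mm (2 ^ w) (mm (packedXPow mm (2 ^ w) fuel (e >>> 1)) (packedXPow mm (2 ^ w) fuel (e >>> 1))))
      (mm (packedXPow mm (2 ^ w) fuel (e >>> 1)) (packedXPow mm (2 ^ w) fuel (e >>> 1)))) _
    rw [Nat.and_one_is_mod]
    rcases Nat.mod_two_eq_zero_or_one e with h0 | h0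
    · rw [show e >>> 1 + e >>> 1 = e by omega] at h2
      rw [h0]
      exact h2
    · have h3 := hmm _ _ _ _ (packsMod_root hn) h2
      rw [← pow_succ', show e >>> 1 + e >>> 1 + 1 = e by omega] at h3
      rw [h0]
      exact h3

-- Both entries stay in the ideal throughout. Leading terms are cancelled by cross-multiplication,
-- which avoids inverses modulo p; `da` and `db` only bound the degrees and drop when a top digit is
-- zero. Exhausted fuel yields `false`, so termination with a constant need not be proved.
open Polynomial in
theorem exists_C_mem_of_packedCoprime (hrd : IsPackedMod p w n rd) (I : Ideal (ZMod p)[X])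
    (fuel a da b db : ℕ) (A B : (ZMod p)[X]) (hda : da ≤ n) (hdb : db ≤ n) (hn : 1 ≤ n)
    (hA : Packs w (da + 1) (p - 1) a A) (hB : Packs w (db + 1) (p - 1) b B) (hAI : A ∈ I)
    (hBI : B ∈ I) (h : packedCoprime rd w p fuel a da b db = true) :
    ∃ c : ZMod p, c ≠ 0 ∧ C c ∈ I := by
  induction fuel generalizing a da b db A B with
  | zero => simp [packedCoprime] at h
  | succ fuel ih =>
    change cond (Nat.beq db 0) (Nat.ble 1 b) (cond (Nat.ble db da)
      (cond (Nat.beq (b >>> (w * db)) 0) (packedCoprime rd w p fuel a da b (db - 1))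
        (packedCoprime rd w p fuel (rd (b >>> (w * db) * a + (p - a >>> (w * da)) *
          b <<< (w * (da - db)))) (da - 1) b db)) (packedCoprime rd w p fuel b db a da)) = true at h
    rcases Nat.eq_zero_or_pos db with rfl | hdb0
    -- Here `b` is a single digit between 1 and p - 1, hence a nonzero constant modulo p.
    · have hb1 : 1 ≤ b := Nat.le_of_ble_eq_true h
      obtain ⟨c, hc1, hc2, hc3, hc4⟩ := hB.exists_digits
      have hbc : b = c 0 := by rw [hc3]; simp
      refine ⟨(b : ℕ), fun h0 => ?_, ?_⟩
      · rw [ZMod.natCast_eq_zero_iff] at h0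
        have h1 := hc1 0
        have := Nat.le_of_dvd hb1 h0
        have := hp.out.pos
        omega
      · convert hBI using 1
        ext i
        rw [coeff_C, hc4]
        split_ifs with hi
        · rw [hi, ← hbc]
        · rw [hc2 i (by omega), Nat.cast_zero]
    · have e1 : Nat.beq db 0 = false := by
        rw [← Bool.not_eq_true, Nat.beq_eq]; omega
      rw [e1, cond_false] at h
      rcases le_or_gt db da with hle | hlt
      · rw [Nat.ble_eq_true_of_le hle, cond_true] at h
        obtain ⟨hb1, hb2⟩ := hB.top_digit hrd.lt
        obtain ⟨ha1, ha2⟩ := hA.top_digit hrd.lt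
        by_cases hlb : b >>> (w * db) = 0
        · rw [hlb] at h
          rw [hlb, Nat.cast_zero] at hb2
          refine ih a da b (db - 1) A B hda (by omega) hA ?_ hAI hBI h
          rw [show db - 1 + 1 = db by omega]
          refine hB.of_coeff_eq_zero fun i hi => ?_
          rcases hi.eq_or_lt with rfl | hi
          · exact hb2.symm
          · obtain ⟨c, hc1, hc2, hc3, hc4⟩ := hB.exists_digits
            rw [hc4, hc2 i hi, Nat.cast_zero]
        · have e2 : Nat.beq (b >>> (w * db)) 0 = false := by
            rw [← Bool.not_eq_true, Nat.beq_eq]; exact hlb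
          rw [e2, cond_false] at h
          -- `p` minus the top digit of `a` represents the negative of the leading coefficient of
          -- `A`, so the terms of degree `da` cancel.
          have hsum := (hA.smul hb1).add (((hB.shiftLeft (da - db)).mono
            (show _ ≤ da + 1 by omega) le_rfl).smul (Nat.sub_le p (a >>> (w * da))))
          have hbd : (p - 1) * (p - 1) + p * (p - 1) ≤ (n + 30) * p * p := by
            refine le_trans ?_ (mul_sq_sub_one_add_le (a := 1) (k := 1) (by omega))
            rw [one_mul, one_mul]
            exact Nat.add_le_add_left (Nat.mul_le_mul_left _ (Nat.sub_le p 1)) _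
          have hnew := hrd.packs (by omega) hbd hsum
          have hnew' := hnew.of_coeff_eq_zero (L' := da - 1 + 1) fun i hi => by
            rw [show da - 1 + 1 = da by omega] at hi
            rw [coeff_add, coeff_C_mul, coeff_C_mul, coeff_X_pow_mul', if_pos (by omega)]
            rcases hi.eq_or_lt with rfl | hi
            · rw [show da - (da - db) = db by omega, ← hb2, ← ha2, Nat.cast_sub (by omega)]
              simp
              ring
            · obtain ⟨c, _, hc2, _, hc4⟩ := hB.exists_digits
              obtain ⟨d, _, hd2, _, hd4⟩ := hA.exists_digits
              rw [hc4, hd4, hc2 _ (by omega), hd2 i hi]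
              simp
          exact ih _ (da - 1) b db _ B (by omega) hdb hnew' hB
            (I.add_mem (I.mul_mem_left _ hAI) (I.mul_mem_left _ (I.mul_mem_left _ hBI))) hBI h
      · have e2 : Nat.ble db da = false := by
          rw [← Bool.not_eq_true, Nat.ble_eq]; omega
        rw [e2, cond_false] at h
        exact ih b db a da B A hdb hda hB hA hBI hAI h

end

/-! ### The executable irreducibility test and its soundness -/

/-- Trial division, for `p < 211 ^ 2`. -/
def trialDivision (p : ℕ) : Bool :=
  Nat.ble 2 p && Nat.ble p 44520 &&
    (List.range 211).all fun d => Nat.ble d 1 || (Nat.ble p d || Nat.ble 1 (Nat.mod p d))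

theorem prime_of_trialDivision {p : ℕ} (h : trialDivision p = true) : p.Prime := by
  simp only [trialDivision, Bool.and_eq_true, List.all_eq_true, List.mem_range, Bool.or_eq_true,
    Nat.ble_eq] at h
  obtain ⟨⟨h2, hlt⟩, h⟩ := h
  refine Nat.prime_def_le_sqrt.2 ⟨h2, fun m hm hms hmp => ?_⟩
  -- The bound 44520 in `trialDivision` is 211² - 1.
  have h3 : m < 211 := by
    have := Nat.sqrt_lt'.2 (show p < 211 ^ 2 by omega)
    omega
  rcases h m h3 with h4 | h4 | h4
  · omega
  · have h5 := Nat.le_sqrt.1 hms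
    have h6 := Nat.mul_le_mul_right m hm
    omega
  · have : p % m = 0 := Nat.mod_eq_zero_of_dvd hmp
    have : Nat.mod p m = 0 := this
    omega

/-- Table of pairs `(e, H)` with `H` packing `X ^ p ^ e` modulo `f`, extended along an addition
chain; its entry `16 i + j` adds the sum of the exponents at positions `i` and `j` of the table. -/
def frobeniusTable (comp : ℕ → ℕ → ℕ) (x h : ℕ) (chain : List ℕ) : List (ℕ × ℕ) :=
  chain.foldl (fun S c => (fun a b => (Nat.add a.1 b.1, comp a.2 b.2) :: S)
    (S.getD (Nat.div c 16) (0, x)) (S.getD (Nat.mod c 16) (0, x))) [(1, h)]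

/-- Packs the product of `X ^ p ^ e - X` over the entries `(e, _)` of `T`. -/
def packedProduct (rd : ℕ → ℕ) (mm : ℕ → ℕ → ℕ) (p w : ℕ) (T : List (ℕ × ℕ)) : ℕ :=
  T.foldr (fun a u => mm (rd (Nat.add a.2 (Nat.shiftLeft (Nat.sub p 1) w))) u) 1

/-- Every proper divisor of `n` divides the exponent of an entry of `T`. -/
def coversDivisors (n : ℕ) (T : List (ℕ × ℕ)) : Bool :=
  (List.range n).all fun d => Nat.ble 1 (Nat.mod n d) || T.any fun a => Nat.beq (Nat.mod a.1 d) 0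

/-- Rabin's test, given the table of Frobenius powers and the entries used for the proper
divisors. -/
noncomputable def rabinTest (rd : ℕ → ℕ) (mm : ℕ → ℕ → ℕ) (p w n f : ℕ) (a : ℕ × ℕ)
    (T : List (ℕ × ℕ)) : Bool :=
  (Nat.beq a.1 n && Nat.beq a.2 (Nat.pow 2 w)) && (coversDivisors n T &&
    packedCoprime rd w p (Nat.mul 3 n) f n (packedProduct rd mm p w T) (Nat.sub n 1))

/-- Rabin's test for the polynomial packed by `f`, with compositions in blocks of 25 digits. -/
noncomputable def rabinTestOfChain (rd : ℕ → ℕ) (mm : ℕ → ℕ → ℕ) (p w n f : ℕ)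
    (chain : List ℕ) (E : List ℕ) : Bool :=
  (fun S => rabinTest rd mm p w n f (S.headD (0, 0)) (E.map fun e => S.getD e (0, Nat.pow 2 w)))
    (frobeniusTable
      (packedComp rd mm w (Nat.sub (Nat.pow 2 w) 1) 24 (Nat.add (Nat.div n 25) 1))
      (Nat.pow 2 w) (packedXPow mm (Nat.pow 2 w) (Nat.add (Nat.log2 p) 1) p) chain)

/-- Rabin's test, with multiplication modulo the polynomial packed by `f`. -/
noncomputable def rabinTestOfPacked (rd : ℕ → ℕ) (p w n f : ℕ) (chain : List ℕ)
    (E : List ℕ) : Bool :=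
  (fun F => rabinTestOfChain rd
    (packedMulMod rd (Nat.mul w n) (Nat.mul w (Nat.sub n 1))
      (packedInverse rd w (Nat.mul w (Nat.sub n 1)) F (Nat.sub n 1)
        (rd (Nat.add F (Nat.shiftLeft 1 (Nat.mul w n)))) 1) F) p w n f chain E)
    (rd (Nat.mul (Nat.sub p 1) f))

/-- Irreducibility test modulo `p` for the polynomial of degree `n` packed by `poly rd w`. -/
noncomputable def irreducibleTest (p n : ℕ) (poly : (ℕ → ℕ) → ℕ → ℕ) (chain : List ℕ)
    (E : List ℕ) : Bool :=
  trialDivision p && (fun C => (fun s => (fun w =>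
    (fun rd => rabinTestOfPacked rd p w n (poly rd w) chain E)
      (packedMod s (Nat.add (Nat.div (Nat.pow 2 s) p) 1) p (digitMask w s (Nat.mul 2 n))))
    (Nat.add (Nat.log2 (Nat.mul C (Nat.add (Nat.div (Nat.pow 2 s) p) 1))) 1))
    (Nat.add (Nat.log2 (Nat.mul (Nat.add C 1) p)) 1))
    (Nat.mul (Nat.mul (Nat.add n 30) p) p)

theorem cast_sub_one_prime (p : ℕ) [hp : Fact p.Prime] : ((p - 1 : ℕ) : ZMod p) = -1 := by
  rw [Nat.cast_sub hp.out.pos]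
  simp

theorem frobeniusTable_spec {p w n : ℕ} {f : Polynomial (ZMod p)} {comp : ℕ → ℕ → ℕ} {x h : ℕ}
    (hcomp : ∀ G H i j, PacksMod w n f G (AdjoinRoot.root f ^ p ^ i) →
      PacksMod w n f H (AdjoinRoot.root f ^ p ^ j) →
        PacksMod w n f (comp G H) (AdjoinRoot.root f ^ p ^ (i + j)))
    (hx : PacksMod w n f x (AdjoinRoot.root f))
    (hh : PacksMod w n f h (AdjoinRoot.root f ^ p)) (chain : List ℕ) :
    ∀ a ∈ frobeniusTable comp x h chain, PacksMod w n f a.2 (AdjoinRoot.root f ^ p ^ a.1) := by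
  have hget : ∀ S : List (ℕ × ℕ), (∀ a ∈ S, PacksMod w n f a.2 (AdjoinRoot.root f ^ p ^ a.1)) →
      ∀ i, PacksMod w n f (S.getD i (0, x)).2 (AdjoinRoot.root f ^ p ^ (S.getD i (0, x)).1) := by
    intro S hS i
    rcases lt_or_ge i S.length with hi | hi
    · rw [List.getD_eq_getElem _ _ hi]
      exact hS _ (List.getElem_mem hi)
    -- The default entry `(0, x)` stands for X^(p^0) = X, so a position outside the table is still a
    -- valid entry.
    · rw [List.getD_eq_default _ _ hi]
      simpa using hx
  have main : ∀ (chain : List ℕ) (S : List (ℕ × ℕ)),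
      (∀ a ∈ S, PacksMod w n f a.2 (AdjoinRoot.root f ^ p ^ a.1)) →
      ∀ a ∈ chain.foldl (fun S c => (fun a b => (Nat.add a.1 b.1, comp a.2 b.2) :: S)
        (S.getD (Nat.div c 16) (0, x)) (S.getD (Nat.mod c 16) (0, x))) S,
        PacksMod w n f a.2 (AdjoinRoot.root f ^ p ^ a.1) := by
    intro chain
    induction chain with
    | nil => exact fun S hS => hS
    | cons c chain ih =>
      intro S hS
      refine ih _ fun a ha => ?_
      rcases List.mem_cons.1 ha with rfl | ha
      · exact hcomp _ _ _ _ (hget S hS _) (hget S hS _)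
      · exact hS a ha
  refine main chain _ fun a ha => ?_
  rw [List.mem_singleton.1 ha, pow_one]
  exact hh

section

variable {p w n : ℕ} [hp : Fact p.Prime] {rd : ℕ → ℕ} {mm : ℕ → ℕ → ℕ} {f : Polynomial (ZMod p)}

open Polynomial in
theorem packedProduct_spec (hrd : IsPackedMod p w n rd) (hmm : IsPackedMulMod w n f mm)
    (hn : 2 ≤ n) (T : List (ℕ × ℕ))
    (hT : ∀ a ∈ T, PacksMod w n f a.2 (AdjoinRoot.root f ^ p ^ a.1)) :
    PacksMod w n f (packedProduct rd mm p w T)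
      (AdjoinRoot.mk f (T.map fun a => (X ^ p ^ a.1 - X : (ZMod p)[X])).prod) := by
  induction T with
  | nil =>
    rw [List.map_nil, List.prod_nil, map_one]
    exact packsMod_one (by omega)
  | cons a T ih =>
    rw [List.map_cons, List.prod_cons, map_mul]
    refine hmm _ _ _ _ ?_ (ih fun b hb => hT b (List.mem_cons_of_mem _ hb))
    obtain ⟨P, hP, hPv⟩ := hT a List.mem_cons_self
    have h1 := hp.out.two_le
    -- The shifted digit p - 1 packs -X.
    have hsub := ((Packs.const (p := p) (w := w) (L := 1) (b := p - 1) (d := p - 1) (by omega)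
      le_rfl).shiftLeft 1).mono (show 1 + 1 ≤ n by omega) le_rfl
    rw [mul_one] at hsub
    have hb : p - 1 + (p - 1) ≤ (n + 30) * p * p := by
      have h2 := le_mul_self_prime p
      have h3 := mul_sq_sub_one_add_le (a := 0) (k := 2) (p := p) (n := n) (by omega)
      rw [zero_mul, zero_add] at h3
      refine le_trans ?_ h3
      have : 2 * p * p = 1 * p * p + 1 * p * p := by ring
      omega
    refine ⟨_, hrd.packs (by omega) hb (hP.add hsub), ?_⟩
    rw [cast_sub_one_prime]
    simp [hPv, sub_eq_add_neg]

open Polynomial in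
theorem irreducible_of_rabinTest (hrd : IsPackedMod p w n rd) (hmm : IsPackedMulMod w n f mm)
    (hn : 2 ≤ n) (hf : f.Monic) (hfn : f.natDegree = n) {fN : ℕ} (hfN : Packs w (n + 1) (p - 1) fN f)
    {a : ℕ × ℕ} (ha : PacksMod w n f a.2 (AdjoinRoot.root f ^ p ^ a.1)) {T : List (ℕ × ℕ)}
    (hT : ∀ a ∈ T, PacksMod w n f a.2 (AdjoinRoot.root f ^ p ^ a.1))
    (h : rabinTest rd mm p w n fN a T = true) : Irreducible f := by
  simp only [rabinTest, Bool.and_eq_true] at h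
  obtain ⟨⟨h1, h2⟩, h3, h4⟩ := h
  replace h1 := Nat.eq_of_beq_eq_true h1
  replace h2 := Nat.eq_of_beq_eq_true h2
  obtain ⟨U, hU, hUv⟩ := packedProduct_spec hrd hmm hn T hT
  obtain ⟨c, hc, hmem⟩ := exists_C_mem_of_packedCoprime hrd (Ideal.span {f, U}) _ _ _ _ _ f U le_rfl
    (show Nat.sub n 1 ≤ n from Nat.sub_le n 1) (by omega) hfN
    (hU.mono (show n ≤ n - 1 + 1 by omega) le_rfl)
    (Ideal.subset_span (by simp)) (Ideal.subset_span (by simp)) h4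
  refine irreducible_of_rabin (n := n) (U := U) hf hfn (by omega) ?_ (T.map Prod.fst) ?_ ?_ hc hmem
  · obtain ⟨P, hP, hPv⟩ := ha
    rw [h1] at hPv
    rw [h2] at hP
    -- Comparing numbers suffices: digits at most p - 1 < 2^w are determined by the packed value.
    have hPX : P = X := hP.unique (packs_X hn) hrd.lt
    rw [hPX, AdjoinRoot.mk_X] at hPv
    rw [← AdjoinRoot.mk_eq_zero, map_sub, map_pow, AdjoinRoot.mk_X, ← hPv, sub_self]
  · intro d hd hdn
    simp only [coversDivisors, List.all_eq_true, List.mem_range, Bool.or_eq_true,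
      List.any_eq_true, Nat.ble_eq] at h3
    rcases h3 d hdn with h5 | ⟨b, hb, hbd⟩
    · have : Nat.mod n d = 0 := Nat.mod_eq_zero_of_dvd hd
      omega
    · exact ⟨b.1, List.mem_map_of_mem hb, Nat.dvd_of_mod_eq_zero (Nat.eq_of_beq_eq_true hbd)⟩
  · rw [← AdjoinRoot.mk_eq_mk, hUv, List.map_map]
    rfl

open Polynomial in
theorem irreducible_of_rabinTestOfChain (hrd : IsPackedMod p w n rd)
    (hmm : IsPackedMulMod w n f mm) (hn : 2 ≤ n) (hf : f.Monic) (hfn : f.natDegree = n) {fN : ℕ}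
    (hfN : Packs w (n + 1) (p - 1) fN f) {chain : List ℕ} {E : List ℕ}
    (h : rabinTestOfChain rd mm p w n fN chain E = true) : Irreducible f := by
  have hx : PacksMod w n f (2 ^ w) (AdjoinRoot.root f) := packsMod_root hn
  -- Powers up to the 24th give blocks of 25 coefficients, and n / 25 + 1 blocks cover all n of
  -- them.
  have htable := frobeniusTable_spec (comp := packedComp rd mm w (2 ^ w - 1) 24 (n / 25 + 1))
    (fun G H i j hG hH => packedComp_spec hrd hmm (packsMod_one (by omega)) (by norm_num)
      (by omega) hG hH) hx
    (packedXPow_spec hmm hn (Nat.log2 p + 1) p Nat.lt_log2_self) chain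
  set S := frobeniusTable (packedComp rd mm w (2 ^ w - 1) 24 (n / 25 + 1)) (2 ^ w)
    (packedXPow mm (2 ^ w) (Nat.log2 p + 1) p) chain with hS
  have h' : rabinTest rd mm p w n fN (S.headD (0, 0)) (E.map fun e => S.getD e (0, 2 ^ w)) = true :=
    h
  refine irreducible_of_rabinTest hrd hmm hn hf hfn hfN ?_ ?_ h'
  · cases hS0 : S with
    -- The default head has exponent 0, which the test compares with n ≥ 2.
    | nil =>
      rw [hS0] at h'
      simp only [rabinTest, Bool.and_eq_true, List.headD_nil] at h'
      have := Nat.eq_of_beq_eq_true h'.1.1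
      omega
    | cons b S' => exact htable b (by rw [hS0]; exact List.mem_cons_self)
  · intro a ha
    obtain ⟨e, _, rfl⟩ := List.mem_map.1 ha
    rcases lt_or_ge e S.length with hi | hi
    · rw [List.getD_eq_getElem _ _ hi]
      exact htable _ (List.getElem_mem hi)
    · rw [List.getD_eq_default _ _ hi]
      simpa using hx

open Polynomial in
theorem irreducible_of_rabinTestOfPacked (hrd : IsPackedMod p w n rd) (hn : 2 ≤ n) (hf : f.Monic)
    (hfn : f.natDegree = n) {fN : ℕ} (hfN : Packs w (n + 1) (p - 1) fN f)
    {chain : List ℕ} {E : List ℕ} (h : rabinTestOfPacked rd p w n fN chain E = true) :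
    Irreducible f := by
  have hp1 := hp.out.two_le
  have hF : Packs w (n + 1) (p - 1) (rd ((p - 1) * fN)) (-f) := by
    have := hrd.packs (by omega) ((Nat.le_add_right _ _).trans
      ((show (p - 1) * (p - 1) + 0 * p * p = 1 * ((p - 1) * (p - 1)) + 0 * p * p by ring).trans_le
        (mul_sq_sub_one_add_le (k := 0) (by omega)))) (hfN.smul le_rfl)
    rw [cast_sub_one_prime] at this
    simpa using this
  have hfc : ∀ i, n + 1 ≤ i → f.coeff i = 0 := fun i hi =>
    coeff_eq_zero_of_natDegree_lt (by omega)
  have hone := (Packs.const (p := p) (w := w) (L := 1) (b := p - 1) (d := 1) (by omega)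
    (by omega))
  -- X^n - f is the remainder of X^n, with quotient 1; its degree is below n because f is monic.
  have hR := hF.add ((hone.shiftLeft n).mono (show _ ≤ n + 1 by omega) le_rfl)
  have hR' := (hrd.packs (by omega) (by
    have h2 := le_mul_self_prime p
    have h3 := mul_sq_sub_one_add_le (a := 0) (k := 2) (p := p) (n := n) (by omega)
    rw [zero_mul, zero_add] at h3
    refine le_trans ?_ h3
    have : 2 * p * p = 1 * p * p + 1 * p * p := by ring
    omega) hR).of_coeff_eq_zero (L' := n) fun i hi => by
      rw [coeff_add, coeff_neg, coeff_X_pow_mul', if_pos hi]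
      rcases hi.eq_or_lt with rfl | hi'
      · have : f.coeff n = 1 := by rw [← hfn]; exact hf
        simp [this]
      · rw [hfc i hi', coeff_C, if_neg (by omega)]
        simp
  -- A further n - 1 division steps lead from X^n to the X^(2n-1) required by Barrett's method.
  obtain ⟨J, e, hJ1, hJ2, hJ3⟩ := packedInverse_spec hrd hn hf hfn hF (n - 1) 1 (by omega) _ _ _ _
    hR' hone (by
      rw [show n - 1 + 1 = n by omega]
      simp)
  rw [show n - 1 + 1 = n by omega] at hJ1
  rw [show n - 1 + (n - 1 + 1) = 2 * n - 1 by omega] at hJ2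
  refine irreducible_of_rabinTestOfChain hrd (mm := packedMulMod rd (w * n) (w * (n - 1)) _ _) ?_
    hn hf hfn hfN h
  intro N M y z hN hM
  exact hN.mulMod hrd hn hfc hF hJ1 hJ2 hJ3 hM

end

-- The exponent `s` makes reciprocal division exact for coefficients up to `C`, and `w` lets such a
-- coefficient times the reciprocal fit into one slot. From p ≤ `C` one gets `s ≤ w`. The polynomial
-- is built by `poly` after `rd` and `w` have been fixed.
open Polynomial in
theorem irreducible_of_irreducibleTest {p n : ℕ} (hn : 2 ≤ n) {f : (ZMod p)[X]} (hf : f.Monic)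
    (hfn : f.natDegree = n) {poly : (ℕ → ℕ) → ℕ → ℕ} {chain : List ℕ} {E : List ℕ}
    (h : irreducibleTest p n poly chain E = true)
    (hpoly : ∀ (rd : ℕ → ℕ) (w : ℕ), p.Prime → IsPackedMod p w n rd →
      Packs w (n + 1) (p - 1) (poly rd w) f) :
    p.Prime ∧ Irreducible f := by
  simp only [irreducibleTest, Bool.and_eq_true] at h
  obtain ⟨hp, h⟩ := h
  replace hp := prime_of_trialDivision hp
  refine ⟨hp, ?_⟩
  have : Fact p.Prime := ⟨hp⟩
  set C := (n + 30) * p * p with hC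
  have hpC : p ≤ C := by
    have := hp.pos
    rw [hC]
    nlinarith [Nat.mul_le_mul this this, Nat.zero_le (n * p * p)]
  set s := Nat.log2 ((C + 1) * p) + 1 with hs
  set w := Nat.log2 (C * (2 ^ s / p + 1)) + 1 with hw
  have h1 : (C + 1) * p ≤ 2 ^ s := Nat.lt_log2_self.le
  have h2 : C * (2 ^ s / p + 1) < 2 ^ w := Nat.lt_log2_self
  have h3 : 2 ^ s ≤ C * (2 ^ s / p + 1) := by
    have := Nat.div_add_mod (2 ^ s) p
    have := Nat.mod_lt (2 ^ s) hp.pos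
    calc 2 ^ s ≤ p * (2 ^ s / p + 1) := by rw [mul_add, mul_one]; omega
      _ ≤ _ := Nat.mul_le_mul_right _ hpC
  have hsw : s ≤ w := ((Nat.pow_lt_pow_iff_right (by norm_num)).1 (h3.trans_lt h2)).le
  have hrd : IsPackedMod p w n (packedMod s (2 ^ s / p + 1) p (digitMask w s (2 * n))) := by
    refine ⟨lt_of_le_of_lt ?_ h2, fun L N P hL hN => ?_⟩
    · exact Nat.le_mul_of_pos_right _ (Nat.succ_pos _)
    · exact Packs.packedMod hp.pos hsw (by omega) h1 h2 hL hN
  exact irreducible_of_rabinTestOfPacked hrd hn hf hfn (hpoly _ w hp hrd) h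

/-! ### Packing the characteristic polynomials modulo p -/

/-- The number with base `2 ^ w` digits `l`, lowest first. -/
noncomputable def packDigits (w : ℕ) (l : List ℕ) : ℕ :=
  List.rec 0 (fun d _ ih => Nat.add d (Nat.shiftLeft ih w)) l

/-- The representative of `-a` modulo `p`. -/
def negMod (p a : ℕ) : ℕ := Nat.mod (Nat.mul (Nat.sub p 1) a) p

/-- Packs `charpolyPair (j + k)` and passes it to `cont`, where `P` and `Q` pack
`charpolyPair j`. -/
noncomputable def packedPair {α : Type} (rd : ℕ → ℕ) (p w : ℕ) (cont : ℕ → ℕ → α) (k : ℕ) :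
    ℕ → ℕ → ℕ → α :=
  Nat.rec (fun _ P Q => cont P Q) (fun _ ih j P Q =>
    ih (Nat.succ j)
      (rd (Nat.add
        (Nat.mul (packDigits w [negMod p (Nat.mul 352 (Nat.succ j)),
          Nat.mod (Nat.add 132 (Nat.mul 128 (Nat.succ j))) p,
          negMod p (Nat.add 36 (Nat.mul 8 (Nat.succ j))), Nat.mod 2 p]) P)
        (Nat.mul (packDigits w [0, 0, negMod p 44, Nat.mod 16 p, Nat.sub p 1]) Q)))
      (rd (Nat.mul (packDigits w [Nat.mod 44 p, negMod p 16, 1]) P))) k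

/-- Packs the characteristic polynomial of `matM y (k + 1)`. -/
noncomputable def packedCharpolyM (p k : ℕ) (rd : ℕ → ℕ) (w : ℕ) : ℕ :=
  packedPair rd p w (fun P _ => P) k 0 (packDigits w [Nat.mod 48 p, negMod p 17, 1])
    (packDigits w [negMod p 13, 1])

/-- Packs the characteristic polynomial of `matN y (k + 1) (k + 2)`, for an inverse `v` of `4`. -/
noncomputable def packedCharpolyN (p k v : ℕ) (rd : ℕ → ℕ) (w : ℕ) : ℕ :=
  packedPair rd p w (fun P Q => rd (Nat.mul v (rd (Nat.add
      (Nat.mul (packDigits w [negMod p (Nat.add (Nat.mul 8 (Nat.succ k)) 4), Nat.mod 5 p]) P)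
      (Nat.mul (packDigits w [0, 0, Nat.sub p 1]) Q))))) k 0
    (packDigits w [Nat.mod 48 p, negMod p 17, 1]) (packDigits w [negMod p 13, 1])

/-- An inverse of `4` modulo odd numbers `p`. -/
def inverseFour (p : ℕ) : ℕ :=
  Nat.mod (Nat.mul (Nat.div (Nat.add p 1) 2) (Nat.div (Nat.add p 1) 2)) p

open Polynomial in
/-- The polynomial with coefficients `l`, lowest first. -/
noncomputable def polyOfDigits (p : ℕ) : List ℕ → (ZMod p)[X]
  | [] => 0
  | d :: l => C (d : ZMod p) + X * polyOfDigits p l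

open Polynomial in
theorem Packs.congr {p w L b N N' : ℕ} {P P' : (ZMod p)[X]} (h : Packs w L b N P) (hN : N = N')
    (hP : P = P') : Packs w L b N' P' := by
  subst hN hP
  exact h

theorem packs_packDigits {p w b : ℕ} (l : List ℕ) (hl : ∀ d ∈ l, d ≤ b) :
    Packs w l.length b (packDigits w l) (polyOfDigits p l) := by
  induction l with
  | nil => exact Packs.zero _ _
  | cons d l ih =>
    exact (ih fun e he => hl e (List.mem_cons_of_mem _ he)).cons (hl d List.mem_cons_self)

section

variable {p w n : ℕ} [hp : Fact p.Prime] {rd : ℕ → ℕ}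

theorem mod_le_sub_one (a : ℕ) : Nat.mod a p ≤ p - 1 :=
  Nat.le_sub_one_of_lt (Nat.mod_lt _ hp.out.pos)

theorem negMod_le (a : ℕ) : negMod p a ≤ p - 1 := mod_le_sub_one _

theorem cast_mod (a : ℕ) : ((Nat.mod a p : ℕ) : ZMod p) = a := ZMod.natCast_mod a p

theorem cast_negMod (a : ℕ) : ((negMod p a : ℕ) : ZMod p) = -a := by
  rw [negMod, cast_mod]
  change (((p - 1) * a : ℕ) : ZMod p) = _
  rw [Nat.cast_mul, cast_sub_one_prime]
  ring

theorem cast_inverseFour (hp2 : p ≠ 2) : (4 : ZMod p) * ((inverseFour p : ℕ) : ZMod p) = 1 := by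
  have hodd := hp.out.eq_two_or_odd.resolve_left hp2
  have h : (2 : ZMod p) * (((p + 1) / 2 : ℕ) : ZMod p) = 1 := by
    have h2 : 2 * ((p + 1) / 2) = p + 1 := by omega
    have := congrArg (Nat.cast : ℕ → ZMod p) h2
    push_cast at this
    simpa using this
  rw [inverseFour, cast_mod]
  change (4 : ZMod p) * (((p + 1) / 2 * ((p + 1) / 2) : ℕ) : ZMod p) = 1
  rw [Nat.cast_mul]
  -- With a = (p + 1) / 2 this is 4a² - 1 = (2a + 1)(2a - 1).
  linear_combination (2 * (((p + 1) / 2 : ℕ) : ZMod p) + 1) * h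

open Polynomial in
/-- The reduction of `charpolyPair k` modulo `p` is packed by `(P, Q)`. -/
def PacksPair (p w k P Q : ℕ) : Prop :=
  Packs w (3 * k + 3) (p - 1) P ((charpolyPair k).1.map (Int.castRingHom (ZMod p))) ∧
    Packs w (3 * k + 2) (p - 1) Q ((charpolyPair k).2.map (Int.castRingHom (ZMod p)))

theorem packsPair_zero :
    PacksPair p w 0 (packDigits w [Nat.mod 48 p, negMod p 17, 1])
      (packDigits w [negMod p 13, 1]) := by
  have h1 : 1 ≤ p - 1 := by have := hp.out.two_le; omega
  constructor
  · refine (packs_packDigits (p := p) (w := w) (b := p - 1) [Nat.mod 48 p, negMod p 17, 1]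
      (by simp [mod_le_sub_one, negMod_le, h1])).congr rfl ?_
    simp [polyOfDigits, charpolyPair, cast_mod, cast_negMod, Polynomial.C_ofNat]
    ring
  · refine (packs_packDigits (p := p) (w := w) (b := p - 1) [negMod p 13, 1]
      (by simp [negMod_le, h1])).congr rfl ?_
    simp [polyOfDigits, charpolyPair, cast_negMod, Polynomial.C_ofNat]
    ring

theorem PacksPair.succ (hrd : IsPackedMod p w n rd) {j P Q : ℕ} (hj : 3 * j + 6 ≤ 2 * n)
    (h : PacksPair p w j P Q) :
    PacksPair p w (j + 1)
      (rd (Nat.add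
        (Nat.mul (packDigits w [negMod p (Nat.mul 352 (Nat.succ j)),
          Nat.mod (Nat.add 132 (Nat.mul 128 (Nat.succ j))) p,
          negMod p (Nat.add 36 (Nat.mul 8 (Nat.succ j))), Nat.mod 2 p]) P)
        (Nat.mul (packDigits w [0, 0, negMod p 44, Nat.mod 16 p, Nat.sub p 1]) Q)))
      (rd (Nat.mul (packDigits w [Nat.mod 44 p, negMod p 16, 1]) P)) := by
  obtain ⟨hP, hQ⟩ := h
  have h1 : 1 ≤ p - 1 := by have := hp.out.two_le; omega
  have d1 := packs_packDigits (p := p) (w := w) (b := p - 1)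
    [negMod p (Nat.mul 352 (Nat.succ j)), Nat.mod (Nat.add 132 (Nat.mul 128 (Nat.succ j))) p,
      negMod p (Nat.add 36 (Nat.mul 8 (Nat.succ j))), Nat.mod 2 p]
    (by simp [mod_le_sub_one, negMod_le])
  have d2 := packs_packDigits (p := p) (w := w) (b := p - 1)
    [0, 0, negMod p 44, Nat.mod 16 p, Nat.sub p 1]
    (by simp [mod_le_sub_one, negMod_le])
  have d3 := packs_packDigits (p := p) (w := w) (b := p - 1)
    [Nat.mod 44 p, negMod p 16, 1] (by simp [mod_le_sub_one, negMod_le, h1])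
  simp only [List.length_cons, List.length_nil] at d1 d2 d3
  constructor
  · have hs := ((d1.mul hP).mono (show _ ≤ 3 * (j + 1) + 3 by omega) le_rfl).add
      ((d2.mul hQ).mono (show _ ≤ 3 * (j + 1) + 3 by omega) le_rfl)
    -- 9 = 4 + 5, the lengths of the two multipliers in the recursion.
    have := hrd.packs (by omega) ((show _ = 9 * ((p - 1) * (p - 1)) + 0 * p * p by ring).trans_le
      (mul_sq_sub_one_add_le (by omega))) hs
    refine this.congr rfl ?_
    simp only [polyOfDigits, charpolyPair, cast_mod, cast_negMod]
    simp [cast_sub_one_prime, Polynomial.C_ofNat]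
    ring
  · have := hrd.packs (by omega) ((Nat.le_add_right _ _).trans
      (mul_sq_sub_one_add_le (k := 0) (by omega)))
      ((d3.mul hP).mono (show _ ≤ 3 * (j + 1) + 2 by omega) le_rfl)
    refine this.congr rfl ?_
    simp only [polyOfDigits, charpolyPair, cast_mod, cast_negMod]
    simp [Polynomial.C_ofNat]
    ring

theorem packedPair_spec {α : Type} (hrd : IsPackedMod p w n rd) (cont : ℕ → ℕ → α) (k j P Q : ℕ)
    (hj : 3 * (j + k) + 3 ≤ 2 * n) (h : PacksPair p w j P Q) :
    ∃ P' Q', PacksPair p w (j + k) P' Q' ∧ packedPair rd p w cont k j P Q = cont P' Q' := by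
  induction k generalizing j P Q with
  | zero => exact ⟨P, Q, h, rfl⟩
  | succ k ih =>
    obtain ⟨P', Q', h1, h2⟩ := ih (j + 1) _ _ (by omega) (h.succ hrd (by omega))
    refine ⟨P', Q', ?_, h2⟩
    rw [show j + (k + 1) = j + 1 + k by omega]
    exact h1

end

-- A factorization of a monic integer polynomial would survive reduction modulo p, so irreducibility
-- modulo p lifts to ℤ, and Gauss's lemma carries it to ℚ.
open Polynomial in
theorem irreducible_charpolyM {p k : ℕ} {f : ℤ[X]} (hf : f.Monic) (hfn : f.natDegree = 3 * k + 2)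
    (hfk : f = (charpolyPair k).1) {chain : List ℕ} {E : List ℕ}
    (h : irreducibleTest p (3 * k + 2) (packedCharpolyM p k) chain E = true) :
    Irreducible (f.map (Int.castRingHom ℚ)) := by
  have hp : p.Prime := by
    simp only [irreducibleTest, Bool.and_eq_true] at h
    exact prime_of_trialDivision h.1
  have : Fact p.Prime := ⟨hp⟩
  obtain ⟨-, hirr⟩ := irreducible_of_irreducibleTest (by omega)
    (hf.map (Int.castRingHom (ZMod p))) (by rw [hf.natDegree_map, hfn]) h fun rd w _ hrd => by
      obtain ⟨P', Q', h1, h2⟩ := packedPair_spec hrd (fun P _ => P) k 0 _ _ (by omega)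
        packsPair_zero
      rw [packedCharpolyM, h2, hfk]
      rw [zero_add] at h1
      exact h1.1
  exact (hf.irreducible_iff_irreducible_map_fraction_map (K := ℚ)).1
    (hf.irreducible_of_irreducible_map _ _ hirr)

-- The recursion yields only 4 f, so modulo an odd prime the packed combination is multiplied by the
-- inverse of 4 before testing.
open Polynomial in
theorem irreducible_charpolyN {p k : ℕ} (hp2 : p ≠ 2) {f : ℤ[X]} (hf : f.Monic)
    (hfn : f.natDegree = 3 * k + 3)
    (hfk : 4 * f = (charpolyPair k).1 * (5 * X - C (8 * (k + 1 : ℤ) + 4)) -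
      X ^ 2 * (charpolyPair k).2) {chain : List ℕ} {E : List ℕ}
    (h : irreducibleTest p (3 * k + 3) (packedCharpolyN p k (inverseFour p)) chain E = true) :
    Irreducible (f.map (Int.castRingHom ℚ)) := by
  have hp : p.Prime := by
    simp only [irreducibleTest, Bool.and_eq_true] at h
    exact prime_of_trialDivision h.1
  have : Fact p.Prime := ⟨hp⟩
  obtain ⟨-, hirr⟩ := irreducible_of_irreducibleTest (by omega)
    (hf.map (Int.castRingHom (ZMod p))) (by rw [hf.natDegree_map, hfn]) h fun rd w _ hrd => by
      obtain ⟨P', Q', h1, h2⟩ := packedPair_spec hrd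
        (fun P Q => rd (Nat.mul (inverseFour p) (rd (Nat.add
          (Nat.mul (packDigits w [negMod p (Nat.add (Nat.mul 8 (Nat.succ k)) 4), Nat.mod 5 p]) P)
          (Nat.mul (packDigits w [0, 0, Nat.sub p 1]) Q))))) k 0 _ _ (by omega) packsPair_zero
      rw [packedCharpolyN, h2]
      rw [zero_add] at h1
      have d1 := packs_packDigits (p := p) (w := w) (b := p - 1)
        [negMod p (Nat.add (Nat.mul 8 (Nat.succ k)) 4), Nat.mod 5 p]
        (by simp [mod_le_sub_one, negMod_le])
      have d2 := packs_packDigits (p := p) (w := w) (b := p - 1) [0, 0, Nat.sub p 1]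
        (by simp)
      simp only [List.length_cons, List.length_nil] at d1 d2
      have hs := ((d1.mul h1.1).mono (show _ ≤ 3 * k + 3 + 1 by omega) le_rfl).add
        ((d2.mul h1.2).mono (show _ ≤ 3 * k + 3 + 1 by omega) le_rfl)
      have hs' := hrd.packs (by omega) ((show _ = 5 * ((p - 1) * (p - 1)) + 0 * p * p by
        ring).trans_le (mul_sq_sub_one_add_le (by omega))) hs
      have hv := hrd.packs (by omega) ((show _ = 1 * ((p - 1) * (p - 1)) + 0 * p * p by
        ring).trans_le (mul_sq_sub_one_add_le (by omega)))
        (hs'.smul (show inverseFour p ≤ p - 1 from mod_le_sub_one _))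
      refine hv.congr rfl ?_
      have h4 : C (((inverseFour p : ℕ) : ZMod p)) * 4 = (1 : (ZMod p)[X]) := by
        have : (4 : (ZMod p)[X]) = C 4 := rfl
        rw [this, ← C_mul, mul_comm, cast_inverseFour hp2, C_1]
      have h5 := congrArg (Polynomial.map (Int.castRingHom (ZMod p))) hfk
      rw [Polynomial.map_mul] at h5
      have h6 : f.map (Int.castRingHom (ZMod p)) = C (((inverseFour p : ℕ) : ZMod p)) *
          (Polynomial.map (Int.castRingHom (ZMod p)) 4 * f.map (Int.castRingHom (ZMod p))) := by
        rw [Polynomial.map_ofNat, ← mul_assoc, h4, one_mul]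
      rw [h6, h5]
      congr 1
      simp only [polyOfDigits, cast_mod, cast_negMod]
      simp [cast_sub_one_prime, Polynomial.C_ofNat]
      ring
  exact (hf.irreducible_iff_irreducible_map_fraction_map (K := ℚ)).1
    (hf.irreducible_of_irreducible_map _ _ hirr)

/-! ### Certificates for 1 ≤ k < 200 -/

/-- Certificates of irreducibility for the two characteristic polynomials at `g = k + 1`. -/
def HasCertificates (k : ℕ) : Prop :=
  (∃ p chain E, irreducibleTest p (3 * k + 2) (packedCharpolyM p k) chain E = true) ∧
    ∃ p chain E, p ≠ 2 ∧
      irreducibleTest p (3 * k + 3) (packedCharpolyN p k (inverseFour p)) chain E = true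

theorem irreducible_of_hasCertificates {k : ℕ} (hk : HasCertificates k) (y : ℕ → ℤ)
    (hy : ∀ i, 1 ≤ i → i ≤ k → y i = (i : ℤ) + 1) :
    Irreducible ((ExplicitMulticurve.matM y (k + 1)).charpoly.map (Int.castRingHom ℚ)) ∧
      Irreducible ((ExplicitMulticurve.matN y (k + 1) (((k + 1 : ℕ) : ℤ) + 1)).charpoly.map
        (Int.castRingHom ℚ)) := by
  obtain ⟨⟨p, chain, E, h⟩, q, chain', E', hq, h'⟩ := hk
  refine ⟨irreducible_charpolyM (Matrix.charpoly_monic _) ?_ (charpoly_matM y k hy) h,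
    irreducible_charpolyN hq (Matrix.charpoly_monic _) ?_ (four_mul_charpoly_matN y k hy) h'⟩
  · rw [Matrix.charpoly_natDegree_eq_dim, Fintype.card_fin]; omega
  · rw [Matrix.charpoly_natDegree_eq_dim, Fintype.card_fin]; omega

/-- Each entry gives a prime, an addition chain and table positions, first for degree 3k + 2, then
for degree 3k + 3. Position 0 is the newest table entry, so code 0 doubles the newest exponent, 1
adds the two newest, and 17 = 16 + 1 doubles the second newest. For instance, `[0, 0, 2, 3, 17, 2,
0]` produces the exponents 1, 2, 4, 5, 6, 10, 15, 30, and positions `[1, 2, 3]` select 15, 10, 6,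
which cover all proper divisors of 30. -/
theorem hasCertificates_of_lt_10 {k : ℕ} (h : 1 ≤ k) (h' : k < 10) : HasCertificates k := by
  interval_cases k
  exacts [
    ⟨⟨37, [0, 0, 2], [3], by decide +kernel⟩,
      23, [0, 1, 0], [1, 2], by decide, by decide +kernel⟩,
    ⟨⟨5, [0, 0, 0], [1], by decide +kernel⟩,
      37, [0, 1, 0, 1], [2], by decide, by decide +kernel⟩,
    ⟨⟨5, [0, 0, 2, 0, 4], [5], by decide +kernel⟩,
      23, [0, 0, 1, 0], [1, 2], by decide, by decide +kernel⟩,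
    ⟨⟨29, [0, 1, 0, 3, 0], [1, 4], by decide +kernel⟩,
      5, [0, 1, 1, 0, 1], [2, 3], by decide, by decide +kernel⟩,
    ⟨⟨79, [0, 0, 0, 0, 4], [5], by decide +kernel⟩,
      79, [0, 1, 0, 1, 0], [1, 2], by decide, by decide +kernel⟩,
    ⟨⟨67, [0, 0, 2, 0, 0], [1, 3], by decide +kernel⟩,
      157, [0, 1, 2, 1, 0, 1], [2, 4], by decide, by decide +kernel⟩,
    ⟨⟨137, [0, 0, 2, 0, 4, 0, 6], [7], by decide +kernel⟩,
      149, [0, 0, 0, 1, 0], [1, 2], by decide, by decide +kernel⟩,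
    ⟨⟨31, [0, 1, 0, 0, 4, 0], [1, 5], by decide +kernel⟩,
      47, [0, 0, 0, 3, 0, 1], [2], by decide, by decide +kernel⟩,
    ⟨⟨463, [0, 1, 0, 3, 0, 0, 6], [7], by decide +kernel⟩,
      241, [0, 0, 2, 3, 17, 2, 0], [1, 2, 3], by decide, by decide +kernel⟩]

theorem hasCertificates_of_lt_20 {k : ℕ} (h : 10 ≤ k) (h' : k < 20) : HasCertificates k := by
  interval_cases k
  exacts [
    ⟨⟨257, [0, 0, 0, 0, 0], [1], by decide +kernel⟩,
      59, [0, 1, 1, 0, 4, 0, 1], [2, 5], by decide, by decide +kernel⟩,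
    ⟨⟨59, [0, 1, 1, 2, 0, 0, 2], [3, 4], by decide +kernel⟩,
      41, [0, 1, 0, 0, 1, 0], [1, 2], by decide, by decide +kernel⟩,
    ⟨⟨37, [0, 0, 0, 3, 0, 5, 0], [1, 6], by decide +kernel⟩,
      193, [0, 1, 1, 0, 2, 0, 1], [2, 5], by decide, by decide +kernel⟩,
    ⟨⟨107, [0, 0, 2, 0, 0, 0, 6], [7], by decide +kernel⟩,
      193, [0, 1, 0, 3, 0, 1, 0], [1, 2, 4], by decide, by decide +kernel⟩,
    ⟨⟨103, [0, 0, 2, 1, 0, 3, 0], [1, 5], by decide +kernel⟩,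
      157, [0, 1, 0, 1, 1, 0, 1], [2, 3], by decide, by decide +kernel⟩,
    ⟨⟨239, [0, 0, 2, 0, 4, 0, 6, 0, 8], [9], by decide +kernel⟩,
      107, [0, 0, 0, 0, 1, 0], [1, 2], by decide, by decide +kernel⟩,
    ⟨⟨373, [0, 0, 2, 0, 1, 1, 0], [1, 3], by decide +kernel⟩,
      1523, [0, 1, 2, 1, 0, 3, 0, 1], [2, 6], by decide, by decide +kernel⟩,
    ⟨⟨157, [0, 1, 0, 0, 4, 0, 0, 7], [8], by decide +kernel⟩,
      1747, [0, 0, 0, 3, 0, 1, 0], [1, 2], by decide, by decide +kernel⟩,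
    ⟨⟨449, [0, 1, 0, 2, 1, 0, 0], [1, 3], by decide +kernel⟩,
      599, [0, 1, 2, 0, 0, 3, 0, 1], [2, 6], by decide, by decide +kernel⟩,
    ⟨⟨109, [0, 1, 0, 3, 0, 0, 6, 0, 8], [9], by decide +kernel⟩,
      59, [0, 0, 0, 2, 3, 17, 2, 0], [1, 2, 3], by decide, by decide +kernel⟩]

theorem hasCertificates_of_lt_30 {k : ℕ} (h : 20 ≤ k) (h' : k < 30) : HasCertificates k := by
  interval_cases k
  exacts [
    ⟨⟨619, [0, 1, 0, 3, 0, 5, 0, 7, 0], [1, 8], by decide +kernel⟩,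
      37, [0, 1, 0, 1, 17, 1, 0, 1], [2, 4], by decide, by decide +kernel⟩,
    ⟨⟨659, [0, 1, 1, 1, 1, 0, 0, 2], [3, 5], by decide +kernel⟩,
      151, [0, 0, 2, 3, 1, 0, 1, 0], [1, 2, 4], by decide, by decide +kernel⟩,
    ⟨⟨101, [0, 0, 0, 0, 4, 0, 0], [1, 5], by decide +kernel⟩,
      241, [0, 1, 1, 0, 0, 3, 0, 1], [2, 6], by decide, by decide +kernel⟩,
    ⟨⟨61, [0, 0, 0, 0, 4, 0, 6, 0, 8], [9], by decide +kernel⟩,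
      197, [0, 1, 0, 0, 0, 1, 0], [1, 2], by decide, by decide +kernel⟩,
    ⟨⟨83, [0, 0, 0, 3, 0, 0, 6, 0], [1, 7], by decide +kernel⟩,
      89, [0, 0, 2, 0, 1, 1, 0, 1], [2, 3], by decide, by decide +kernel⟩,
    ⟨⟨337, [0, 1, 2, 1, 1, 0, 1, 0, 3], [4, 5], by decide +kernel⟩,
      1013, [0, 1, 0, 3, 1, 0, 1, 0], [1, 2, 5], by decide, by decide +kernel⟩,
    ⟨⟨829, [0, 0, 0, 0, 2, 0, 0], [1, 3], by decide +kernel⟩,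
      1217, [0, 1, 0, 0, 4, 0, 6, 0, 1], [2], by decide, by decide +kernel⟩,
    ⟨⟨107, [0, 0, 2, 0, 0, 0, 6, 0, 8], [9], by decide +kernel⟩,
      131, [0, 1, 0, 0, 3, 0, 1, 0], [1, 2, 4], by decide, by decide +kernel⟩,
    ⟨⟨677, [0, 0, 0, 2, 0, 0, 5, 7, 0], [1, 8], by decide +kernel⟩,
      839, [0, 1, 2, 1, 0, 0, 6, 0, 1], [2, 7], by decide, by decide +kernel⟩,
    ⟨⟨83, [0, 0, 2, 0, 4, 0, 0, 0, 8], [9], by decide +kernel⟩,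
      43, [0, 1, 0, 1, 1, 17, 17, 2, 0], [1, 2, 3], by decide, by decide +kernel⟩]

theorem hasCertificates_of_lt_40 {k : ℕ} (h : 30 ≤ k) (h' : k < 40) : HasCertificates k := by
  interval_cases k
  exacts [
    ⟨⟨997, [0, 1, 2, 1, 1, 0, 6, 0, 0], [1, 6], by decide +kernel⟩,
      1367, [0, 1, 2, 1, 0, 0, 4, 0, 1], [2, 7], by decide, by decide +kernel⟩,
    ⟨⟨463, [0, 0, 2, 1, 1, 2, 0, 0, 2], [3, 6], by decide +kernel⟩,
      193, [0, 0, 0, 0, 0, 1, 0], [1, 2], by decide, by decide +kernel⟩,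
    ⟨⟨53, [0, 1, 0, 0, 3, 17, 0, 7, 0], [1, 4], by decide +kernel⟩,
      389, [0, 1, 0, 1, 17, 0, 2, 0, 1], [2, 5], by decide, by decide +kernel⟩,
    ⟨⟨241, [0, 1, 0, 0, 0, 5, 0, 0, 8], [9], by decide +kernel⟩,
      101, [0, 0, 2, 3, 1, 1, 0, 1, 0], [1, 2, 5], by decide, by decide +kernel⟩,
    ⟨⟨743, [0, 0, 0, 3, 0, 2, 0, 0], [1, 5], by decide +kernel⟩,
      379, [0, 0, 2, 0, 1, 17, 6, 18, 0, 1], [2, 3, 5], by decide, by decide +kernel⟩,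
    ⟨⟨1231, [0, 1, 0, 0, 4, 0, 0, 7, 0, 9], [10], by decide +kernel⟩,
      743, [0, 0, 0, 3, 0, 0, 1, 0], [1, 2], by decide, by decide +kernel⟩,
    ⟨⟨887, [0, 0, 2, 0, 4, 0, 1, 1, 0], [1, 3, 5], by decide +kernel⟩,
      353, [0, 1, 0, 1, 0, 0, 6, 0, 1], [2, 7], by decide, by decide +kernel⟩,
    ⟨⟨131, [0, 1, 0, 3, 0, 0, 0, 0, 8], [9], by decide +kernel⟩,
      2137, [0, 1, 0, 0, 4, 2, 0, 1, 0], [1, 2, 6], by decide, by decide +kernel⟩,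
    ⟨⟨211, [0, 0, 0, 1, 0, 5, 4, 0, 0], [1, 7], by decide +kernel⟩,
      829, [0, 1, 0, 1, 1, 0, 2, 0, 1], [2, 5], by decide, by decide +kernel⟩,
    ⟨⟨193, [0, 1, 2, 1, 0, 3, 17, 0, 0, 5], [4, 6], by decide +kernel⟩,
      47, [0, 0, 0, 0, 2, 3, 17, 2, 0], [1, 2, 3], by decide, by decide +kernel⟩]

theorem hasCertificates_of_lt_50 {k : ℕ} (h : 40 ≤ k) (h' : k < 50) : HasCertificates k := by
  interval_cases k
  exacts [
    ⟨⟨4133, [0, 0, 1, 0, 4, 4, 0, 0, 8, 0], [1, 9], by decide +kernel⟩,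
      179, [0, 1, 1, 0, 0, 0, 6, 0, 1], [2, 7], by decide, by decide +kernel⟩,
    ⟨⟨193, [0, 1, 0, 0, 0, 5, 0, 0, 2], [3], by decide +kernel⟩,
      307, [0, 1, 0, 1, 0, 3, 0, 1, 0], [1, 2, 4], by decide, by decide +kernel⟩,
    ⟨⟨557, [0, 0, 0, 0, 0, 0, 0], [1], by decide +kernel⟩,
      163, [0, 1, 1, 0, 0, 0, 4, 0, 1], [2, 7], by decide, by decide +kernel⟩,
    ⟨⟨1117, [0, 0, 0, 0, 0, 0, 6, 0, 8], [9], by decide +kernel⟩,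
      179, [0, 1, 1, 0, 3, 1, 0, 1, 0], [1, 2, 4], by decide, by decide +kernel⟩,
    ⟨⟨541, [0, 0, 0, 0, 0, 0, 6, 6, 0], [1, 8], by decide +kernel⟩,
      1759, [0, 0, 0, 3, 0, 1, 1, 0, 1], [2, 3], by decide, by decide +kernel⟩,
    ⟨⟨269, [0, 0, 0, 0, 4, 0, 0, 0, 8], [9], by decide +kernel⟩,
      373, [0, 0, 2, 3, 1, 1, 2, 0, 1, 0], [1, 2, 6], by decide, by decide +kernel⟩,
    ⟨⟨2039, [0, 1, 0, 3, 0, 2, 17, 3, 0, 0], [1, 3, 4], by decide +kernel⟩,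
      4391, [0, 1, 1, 0, 4, 0, 0, 5, 0, 1], [2, 8], by decide, by decide +kernel⟩,
    ⟨⟨421, [0, 0, 0, 3, 3, 4, 0, 0, 2, 0, 4], [5, 6], by decide +kernel⟩,
      1663, [0, 1, 0, 0, 0, 0, 1, 0], [1, 2], by decide, by decide +kernel⟩,
    ⟨⟨281, [0, 0, 0, 3, 0, 0, 0, 7, 0], [1, 8], by decide +kernel⟩,
      739, [0, 1, 0, 3, 0, 1, 17, 1, 0, 1], [2, 4], by decide, by decide +kernel⟩,
    ⟨⟨367, [0, 0, 0, 3, 0, 0, 6, 0, 0, 9], [10], by decide +kernel⟩,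
      947, [0, 0, 2, 0, 1, 1, 17, 17, 2, 0], [1, 2, 3], by decide, by decide +kernel⟩]

theorem hasCertificates_of_lt_60 {k : ℕ} (h : 50 ≤ k) (h' : k < 60) : HasCertificates k := by
  interval_cases k
  exacts [
    ⟨⟨827, [0, 0, 0, 3, 0, 5, 0, 0, 0], [1, 6], by decide +kernel⟩,
      269, [0, 0, 0, 3, 17, 1, 0, 7, 0, 1], [2, 6], by decide, by decide +kernel⟩,
    ⟨⟨439, [0, 0, 2, 17, 1, 0, 3, 0, 0, 2], [3, 7], by decide +kernel⟩,
      1481, [0, 1, 0, 0, 4, 0, 0, 1, 0], [1, 2, 5], by decide, by decide +kernel⟩,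
    ⟨⟨359, [0, 0, 0, 3, 0, 5, 0, 0, 8, 8, 0], [1, 10], by decide +kernel⟩,
      1069, [0, 1, 1, 0, 2, 0, 0, 7, 0, 1], [2, 8], by decide, by decide +kernel⟩,
    ⟨⟨607, [0, 1, 2, 1, 1, 0, 6, 0, 1, 0, 3], [4, 7], by decide +kernel⟩,
      83, [0, 1, 0, 0, 4, 0, 6, 0, 1, 0], [1, 2], by decide, by decide +kernel⟩,
    ⟨⟨883, [0, 0, 2, 0, 0, 0, 6, 0, 0], [1, 7], by decide +kernel⟩,
      419, [0, 0, 2, 0, 4, 3, 17, 2, 1, 0, 1], [2, 3, 5], by decide, by decide +kernel⟩,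
    ⟨⟨2143, [0, 0, 2, 0, 0, 0, 6, 0, 8, 0, 10], [11], by decide +kernel⟩,
      139, [0, 0, 1, 0, 0, 3, 0, 1, 0], [1, 2, 4], by decide, by decide +kernel⟩,
    ⟨⟨263, [0, 0, 0, 2, 17, 5, 0, 1, 1, 0], [1, 3, 6], by decide +kernel⟩,
      3049, [0, 1, 0, 1, 17, 0, 0, 3, 0, 1], [2, 6], by decide, by decide +kernel⟩,
    ⟨⟨619, [0, 0, 2, 0, 0, 5, 0, 7, 0, 0, 10], [11], by decide +kernel⟩,
      8419, [0, 1, 0, 3, 0, 0, 6, 0, 1, 0], [1, 2, 7], by decide, by decide +kernel⟩,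
    ⟨⟨409, [0, 0, 0, 0, 3, 0, 0, 3, 0], [1, 5], by decide +kernel⟩,
      1567, [0, 1, 2, 1, 0, 0, 0, 5, 0, 1], [2, 8], by decide, by decide +kernel⟩,
    ⟨⟨857, [0, 0, 2, 0, 4, 0, 0, 0, 8, 0, 10], [11], by decide +kernel⟩,
      2579, [0, 1, 0, 1, 1, 0, 3, 17, 2, 0], [1, 2, 3], by decide, by decide +kernel⟩]

theorem hasCertificates_of_lt_70 {k : ℕ} (h : 60 ≤ k) (h' : k < 70) : HasCertificates k := by
  interval_cases k
  exacts [
    ⟨⟨283, [0, 1, 0, 0, 4, 5, 17, 2, 1, 2, 0], [1, 4, 5], by decide +kernel⟩,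
      761, [0, 1, 0, 0, 2, 0, 0, 7, 0, 1], [2, 8], by decide, by decide +kernel⟩,
    ⟨⟨1471, [0, 0, 2, 1, 0, 0, 6, 0, 0, 2], [3, 7], by decide +kernel⟩,
      2347, [0, 1, 0, 0, 0, 5, 3, 0, 1, 0], [1, 2, 7], by decide, by decide +kernel⟩,
    ⟨⟨499, [0, 1, 2, 1, 1, 0, 0, 7, 0, 6, 0], [1, 8], by decide +kernel⟩,
      107, [0, 0, 0, 3, 0, 1, 17, 1, 0, 1], [2, 4], by decide, by decide +kernel⟩,
    ⟨⟨197, [0, 0, 2, 0, 4, 0, 6, 0, 8, 0, 10, 0, 12], [13], by decide +kernel⟩,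
      5309, [0, 0, 0, 0, 0, 0, 1, 0], [1, 2], by decide, by decide +kernel⟩,
    ⟨⟨389, [0, 1, 0, 0, 0, 0, 0, 7, 0], [1, 8], by decide +kernel⟩,
      5737, [0, 0, 1, 0, 4, 4, 17, 2, 1, 0, 1], [2, 3, 5], by decide, by decide +kernel⟩,
    ⟨⟨2741, [0, 1, 0, 0, 0, 0, 6, 0, 0, 9], [10], by decide +kernel⟩,
      239, [0, 1, 0, 1, 1, 17, 1, 0, 1, 0], [1, 2, 4], by decide, by decide +kernel⟩,
    ⟨⟨149, [0, 0, 2, 0, 0, 0, 2, 0, 0], [1, 3], by decide +kernel⟩,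
      463, [0, 1, 2, 0, 0, 0, 0, 5, 0, 1], [2, 8], by decide, by decide +kernel⟩,
    ⟨⟨467, [0, 1, 0, 3, 0, 0, 6, 0, 1, 0, 3], [4, 7], by decide +kernel⟩,
      6619, [0, 0, 2, 3, 0, 2, 0, 0, 1, 0], [1, 2, 5], by decide, by decide +kernel⟩,
    ⟨⟨1249, [0, 0, 1, 0, 0, 5, 0, 7, 0, 9, 0], [1, 10], by decide +kernel⟩,
      349, [0, 0, 0, 3, 1, 0, 0, 7, 0, 1], [2, 6], by decide, by decide +kernel⟩,
    ⟨⟨227, [0, 1, 2, 0, 2, 1, 0, 0, 2, 0, 4], [5, 6], by decide +kernel⟩,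
      709, [0, 0, 2, 2, 17, 2, 0, 4, 4, 17, 2, 0], [1, 2, 3, 5], by decide, by decide +kernel⟩]

theorem hasCertificates_of_lt_80 {k : ℕ} (h : 70 ≤ k) (h' : k < 80) : HasCertificates k := by
  interval_cases k
  exacts [
    ⟨⟨1867, [0, 0, 2, 1, 2, 0, 0, 7, 0, 0], [1, 8], by decide +kernel⟩,
      823, [0, 1, 2, 0, 0, 5, 0, 0, 6, 0, 1], [2, 9], by decide, by decide +kernel⟩,
    ⟨⟨3929, [0, 0, 2, 0, 0, 5, 0, 7, 0, 0, 2], [3, 8], by decide +kernel⟩,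
      1787, [0, 0, 0, 3, 0, 0, 0, 1, 0], [1, 2], by decide, by decide +kernel⟩,
    ⟨⟨3517, [0, 1, 0, 0, 0, 4, 6, 0, 0, 9, 0], [1, 10], by decide +kernel⟩,
      1789, [0, 1, 0, 1, 0, 0, 0, 7, 0, 1], [2, 8], by decide, by decide +kernel⟩,
    ⟨⟨1511, [0, 0, 2, 1, 2, 3, 17, 0, 0, 0, 5], [5, 6], by decide +kernel⟩,
      1997, [0, 1, 0, 1, 0, 0, 6, 0, 1, 0], [1, 2, 7], by decide, by decide +kernel⟩,
    ⟨⟨947, [0, 0, 0, 0, 0, 2, 0, 2, 0], [1, 4], by decide +kernel⟩,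
      641, [0, 1, 0, 3, 0, 5, 0, 1, 1, 0, 1], [2, 3], by decide, by decide +kernel⟩,
    ⟨⟨6323, [0, 1, 0, 3, 0, 0, 0, 0, 8, 0, 10], [11], by decide +kernel⟩,
      307, [0, 1, 0, 3, 17, 1, 0, 0, 1, 0], [1, 2, 5], by decide, by decide +kernel⟩,
    ⟨⟨1427, [0, 1, 1, 0, 2, 1, 0, 1, 1, 0], [1, 3, 6], by decide +kernel⟩,
      641, [0, 1, 1, 0, 4, 1, 5, 3, 18, 1, 0, 1], [2, 4, 6], by decide, by decide +kernel⟩,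
    ⟨⟨1117, [0, 1, 0, 3, 0, 0, 6, 0, 0, 0, 10], [11], by decide +kernel⟩,
      241, [0, 1, 0, 1, 0, 3, 1, 0, 1, 0], [1, 2, 5], by decide, by decide +kernel⟩,
    ⟨⟨4817, [0, 0, 1, 0, 0, 5, 4, 0, 8, 0, 0], [1, 9], by decide +kernel⟩,
      5623, [0, 1, 0, 1, 0, 0, 4, 0, 8, 0, 1], [2, 9], by decide, by decide +kernel⟩,
    ⟨⟨4021, [0, 1, 0, 3, 0, 0, 6, 0, 8, 0, 10, 0, 12], [13], by decide +kernel⟩,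
      2467, [0, 0, 0, 0, 0, 2, 3, 17, 2, 0], [1, 2, 3], by decide, by decide +kernel⟩]

theorem hasCertificates_of_lt_90 {k : ℕ} (h : 80 ≤ k) (h' : k < 90) : HasCertificates k := by
  interval_cases k
  exacts [
    ⟨⟨439, [0, 1, 2, 0, 2, 0, 2, 0, 0, 9, 0], [1, 5], by decide +kernel⟩,
      1861, [0, 0, 2, 0, 0, 0, 0, 7, 0, 1], [2], by decide, by decide +kernel⟩,
    ⟨⟨401, [0, 1, 0, 3, 0, 1, 1, 2, 0, 0, 2], [3, 4], by decide +kernel⟩,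
      883, [0, 0, 1, 1, 0, 0, 6, 0, 1, 0], [1, 2, 7], by decide, by decide +kernel⟩,
    ⟨⟨1663, [0, 1, 0, 3, 4, 1, 1, 2, 0, 0, 0], [1, 6], by decide +kernel⟩,
      787, [0, 1, 1, 0, 0, 0, 0, 5, 0, 1], [2, 8], by decide, by decide +kernel⟩,
    ⟨⟨4339, [0, 1, 0, 3, 0, 5, 0, 7, 0, 0, 10, 0, 12], [13], by decide +kernel⟩,
      1289, [0, 1, 0, 0, 1, 0, 3, 0, 1, 0], [1, 2, 4], by decide, by decide +kernel⟩,
    ⟨⟨563, [0, 1, 0, 3, 0, 0, 6, 6, 0, 0, 10, 10, 0], [1, 12], by decide +kernel⟩,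
      2939, [0, 1, 0, 1, 1, 2, 0, 3, 17, 9, 0, 1], [2, 4, 7], by decide, by decide +kernel⟩,
    ⟨⟨101, [0, 0, 0, 0, 0, 0, 0, 0, 8], [9], by decide +kernel⟩,
      1567, [0, 1, 0, 1, 0, 0, 3, 7, 0, 1, 0], [1, 2, 8], by decide, by decide +kernel⟩,
    ⟨⟨3433, [0, 1, 1, 0, 2, 17, 17, 0, 3, 0, 0], [1, 3, 5], by decide +kernel⟩,
      5227, [0, 1, 0, 1, 1, 0, 2, 0, 4, 0, 1], [2, 7], by decide, by decide +kernel⟩,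
    ⟨⟨509, [0, 0, 0, 0, 0, 0, 6, 0, 8, 0, 10], [11], by decide +kernel⟩,
      1093, [0, 0, 2, 0, 0, 3, 1, 0, 1, 0], [1, 2, 4], by decide, by decide +kernel⟩,
    ⟨⟨3181, [0, 0, 2, 2, 0, 2, 0, 1, 1, 2, 0], [1, 4, 6], by decide +kernel⟩,
      983, [0, 1, 1, 0, 0, 0, 4, 0, 6, 0, 1], [2, 9], by decide, by decide +kernel⟩,
    ⟨⟨1949, [0, 0, 0, 0, 0, 5, 0, 7, 0, 0, 10], [11], by decide +kernel⟩,
      419, [0, 0, 0, 3, 0, 1, 0, 1, 4, 18, 0], [1, 2, 4], by decide, by decide +kernel⟩]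

theorem hasCertificates_of_lt_100 {k : ℕ} (h : 90 ≤ k) (h' : k < 100) : HasCertificates k := by
  interval_cases k
  exacts [
    ⟨⟨313, [0, 0, 0, 0, 4, 0, 0, 0, 0], [1, 5], by decide +kernel⟩,
      821, [0, 0, 2, 17, 1, 1, 17, 2, 17, 1, 0, 1], [2, 4, 6], by decide, by decide +kernel⟩,
    ⟨⟨1019, [0, 0, 2, 0, 0, 2, 3, 1, 0, 0, 2], [3, 5], by decide +kernel⟩,
      3499, [0, 0, 2, 0, 4, 5, 1, 0, 0, 1, 0], [1, 2, 5], by decide, by decide +kernel⟩,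
    ⟨⟨3011, [0, 0, 0, 0, 0, 4, 0, 0, 7, 9, 0], [1, 10], by decide +kernel⟩,
      1033, [0, 0, 2, 1, 1, 1, 0, 0, 8, 0, 1], [2, 7], by decide, by decide +kernel⟩,
    ⟨⟨1667, [0, 0, 0, 0, 4, 0, 6, 0, 0, 0, 10], [11], by decide +kernel⟩,
      367, [0, 0, 1, 1, 0, 0, 6, 4, 0, 1, 0], [1, 2, 8], by decide, by decide +kernel⟩,
    ⟨⟨5501, [0, 0, 0, 0, 4, 0, 6, 0, 8, 0, 0], [1, 9], by decide +kernel⟩,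
      2213, [0, 1, 2, 1, 0, 5, 3, 0, 1, 1, 0, 1], [2, 3, 6], by decide, by decide +kernel⟩,
    ⟨⟨919, [0, 1, 1, 2, 17, 0, 0, 7, 0, 1, 0, 3], [4, 8], by decide +kernel⟩,
      367, [0, 1, 0, 0, 0, 0, 0, 1, 0], [1, 2], by decide, by decide +kernel⟩,
    ⟨⟨4583, [0, 0, 2, 0, 2, 0, 6, 0, 1, 1, 0], [1, 3, 7], by decide +kernel⟩,
      1949, [0, 1, 0, 0, 0, 0, 0, 7, 0, 1], [2, 8], by decide, by decide +kernel⟩,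
    ⟨⟨269, [0, 0, 0, 3, 0, 0, 0, 7, 0, 0, 10], [11], by decide +kernel⟩,
      5309, [0, 1, 0, 3, 0, 1, 0, 3, 0, 1, 0], [1, 2, 4], by decide, by decide +kernel⟩,
    ⟨⟨12653, [0, 0, 0, 0, 0, 5, 0, 4, 0, 0], [1, 7], by decide +kernel⟩,
      4517, [0, 0, 0, 3, 0, 1, 17, 0, 2, 0, 1], [2, 5], by decide, by decide +kernel⟩,
    ⟨⟨1493, [0, 1, 1, 0, 2, 1, 0, 1, 0, 0, 4], [5, 6], by decide +kernel⟩,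
      3001, [0, 0, 2, 0, 0, 1, 1, 17, 17, 2, 0], [1, 2, 3], by decide, by decide +kernel⟩]

theorem hasCertificates_of_lt_110 {k : ℕ} (h : 100 ≤ k) (h' : k < 110) : HasCertificates k := by
  interval_cases k
  exacts [
    ⟨⟨2803, [0, 0, 0, 3, 0, 0, 0, 7, 7, 0, 10, 0], [1, 11], by decide +kernel⟩,
      1907, [0, 1, 0, 0, 0, 0, 6, 0, 6, 0, 1], [2, 9], by decide, by decide +kernel⟩,
    ⟨⟨359, [0, 0, 2, 0, 1, 0, 0, 7, 0, 0, 2], [3, 8], by decide +kernel⟩,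
      5189, [0, 1, 0, 0, 2, 3, 1, 1, 0, 1, 0], [1, 2, 5], by decide, by decide +kernel⟩,
    ⟨⟨2633, [0, 0, 2, 3, 1, 0, 2, 17, 5, 2, 0, 0], [1, 4, 5], by decide +kernel⟩,
      521, [0, 1, 0, 0, 0, 5, 0, 0, 6, 0, 1], [2, 9], by decide, by decide +kernel⟩,
    ⟨⟨757, [0, 0, 0, 3, 0, 5, 0, 0, 8, 0, 10, 0, 12], [13], by decide +kernel⟩,
      2927, [0, 0, 1, 0, 0, 4, 0, 0, 1, 0], [1, 2, 5], by decide, by decide +kernel⟩,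
    ⟨⟨347, [0, 0, 0, 3, 0, 5, 0, 7, 0, 0, 10, 0], [1, 11], by decide +kernel⟩,
      2731, [0, 1, 0, 1, 0, 3, 0, 5, 3, 2, 0, 1], [2, 3, 4], by decide, by decide +kernel⟩,
    ⟨⟨1597, [0, 0, 0, 3, 0, 5, 0, 7, 0, 9, 0, 0, 12], [13], by decide +kernel⟩,
      1559, [0, 1, 0, 3, 1, 0, 0, 7, 0, 1, 0], [1, 2, 8], by decide, by decide +kernel⟩,
    ⟨⟨277, [0, 0, 0, 0, 0, 0, 2, 0, 0], [1, 3], by decide +kernel⟩,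
      2011, [0, 1, 1, 0, 2, 0, 0, 0, 6, 0, 1], [2, 9], by decide, by decide +kernel⟩,
    ⟨⟨5303, [0, 0, 0, 0, 4, 4, 0, 0, 0, 0, 4], [5, 6], by decide +kernel⟩,
      2411, [0, 1, 0, 0, 4, 0, 6, 0, 0, 1, 0], [1, 2], by decide, by decide +kernel⟩,
    ⟨⟨311, [0, 1, 1, 0, 0, 0, 0, 0, 7, 9, 0], [1, 10], by decide +kernel⟩,
      3527, [0, 1, 0, 0, 0, 3, 0, 0, 8, 0, 1], [2, 9], by decide, by decide +kernel⟩,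
    ⟨⟨3659, [0, 1, 1, 2, 17, 0, 0, 3, 0, 1, 0, 3], [4, 8], by decide +kernel⟩,
      521, [0, 0, 2, 0, 4, 3, 2, 17, 1, 4, 17, 2, 0], [1, 2, 3, 5], by decide, by decide +kernel⟩]

theorem hasCertificates_of_lt_120 {k : ℕ} (h : 110 ≤ k) (h' : k < 120) : HasCertificates k := by
  interval_cases k
  exacts [
    ⟨⟨5507, [0, 0, 2, 0, 0, 0, 0, 7, 0, 7, 0], [1, 9], by decide +kernel⟩,
      379, [0, 1, 0, 1, 2, 1, 0, 3, 0, 5, 0, 1], [2, 8], by decide, by decide +kernel⟩,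
    ⟨⟨5477, [0, 0, 2, 17, 1, 0, 3, 0, 5, 0, 0, 2], [3, 9], by decide +kernel⟩,
      953, [0, 0, 0, 0, 1, 0, 3, 0, 1, 0], [1, 2, 4], by decide, by decide +kernel⟩,
    ⟨⟨409, [0, 0, 0, 2, 17, 1, 1, 0, 0, 9, 0], [1, 5], by decide +kernel⟩,
      2083, [0, 1, 2, 1, 0, 0, 0, 0, 8, 0, 1], [2, 9], by decide, by decide +kernel⟩,
    ⟨⟨659, [0, 0, 2, 0, 4, 17, 1, 0, 0, 2, 0, 4], [5, 7], by decide +kernel⟩,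
      4261, [0, 1, 0, 1, 0, 3, 1, 2, 0, 1, 0], [1, 2, 6], by decide, by decide +kernel⟩,
    ⟨⟨1723, [0, 0, 0, 3, 1, 0, 6, 4, 0, 0, 0], [1, 8], by decide +kernel⟩,
      2521, [0, 1, 0, 3, 4, 1, 1, 0, 1, 1, 0, 1], [2, 3, 6], by decide, by decide +kernel⟩,
    ⟨⟨577, [0, 0, 2, 0, 0, 5, 0, 7, 0, 0, 10, 0, 12], [13], by decide +kernel⟩,
      3823, [0, 0, 1, 0, 2, 5, 2, 0, 0, 1, 0], [1, 2, 7], by decide, by decide +kernel⟩,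
    ⟨⟨313, [0, 0, 2, 0, 1, 1, 0, 4, 3, 18, 1, 0], [1, 3, 5], by decide +kernel⟩,
      5563, [0, 0, 0, 3, 0, 1, 1, 0, 2, 0, 1], [2, 5], by decide, by decide +kernel⟩,
    ⟨⟨2393, [0, 0, 2, 0, 4, 0, 0, 0, 0, 0, 10], [11], by decide +kernel⟩,
      937, [0, 1, 0, 3, 1, 0, 0, 4, 8, 0, 1, 0], [1, 2, 9], by decide, by decide +kernel⟩,
    ⟨⟨6011, [0, 0, 2, 0, 4, 0, 0, 0, 8, 0, 0], [1, 9], by decide +kernel⟩,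
      2617, [0, 0, 0, 0, 4, 3, 17, 2, 17, 1, 0, 1], [2, 4, 6], by decide, by decide +kernel⟩,
    ⟨⟨2069, [0, 0, 2, 0, 4, 0, 0, 0, 8, 0, 10, 0, 12], [13], by decide +kernel⟩,
      457, [0, 1, 0, 0, 2, 0, 0, 3, 17, 2, 0], [1, 2, 3], by decide, by decide +kernel⟩]

theorem hasCertificates_of_lt_130 {k : ℕ} (h : 120 ≤ k) (h' : k < 130) : HasCertificates k := by
  interval_cases k
  exacts [
    ⟨⟨691, [0, 0, 0, 3, 3, 0, 0, 7, 0, 0, 10, 0], [1, 11], by decide +kernel⟩,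
      10271, [0, 0, 2, 0, 4, 0, 1, 17, 0, 2, 0, 1], [2, 5], by decide, by decide +kernel⟩,
    ⟨⟨1307, [0, 0, 2, 1, 0, 0, 0, 7, 0, 0, 2], [3, 8], by decide +kernel⟩,
      587, [0, 1, 0, 0, 0, 2, 0, 7, 0, 1, 0], [1, 2, 8], by decide, by decide +kernel⟩,
    ⟨⟨1709, [0, 1, 0, 3, 4, 0, 2, 0, 0, 0, 0], [1, 5], by decide +kernel⟩,
      313, [0, 1, 0, 1, 2, 0, 0, 3, 0, 5, 0, 1], [2, 8], by decide, by decide +kernel⟩,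
    ⟨⟨983, [0, 1, 0, 3, 1, 0, 0, 7, 0, 1, 0, 3], [4, 8], by decide +kernel⟩,
      12263, [0, 1, 0, 0, 1, 5, 2, 0, 0, 1, 0], [1, 2, 7], by decide, by decide +kernel⟩,
    ⟨⟨479, [0, 0, 2, 3, 1, 1, 17, 17, 6, 0, 0, 11, 4, 0], [1, 6, 7], by decide +kernel⟩,
      983, [0, 1, 0, 0, 0, 5, 0, 1, 1, 0, 1], [2, 3], by decide, by decide +kernel⟩,
    ⟨⟨971, [0, 0, 2, 17, 1, 17, 1, 0, 1, 0, 0, 4], [5, 7], by decide +kernel⟩,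
      4159, [0, 0, 0, 3, 0, 1, 0, 3, 0, 1, 0], [1, 2, 4], by decide, by decide +kernel⟩,
    ⟨⟨1567, [0, 0, 0, 3, 0, 5, 6, 17, 0, 3, 0, 0], [1, 3, 5], by decide +kernel⟩,
      311, [0, 1, 0, 0, 2, 0, 0, 5, 0, 9, 0, 1], [2, 10], by decide, by decide +kernel⟩,
    ⟨⟨1621, [0, 0, 2, 0, 4, 0, 6, 0, 8, 0, 10, 0, 12, 0, 14], [15], by decide +kernel⟩,
      839, [0, 0, 0, 0, 0, 0, 0, 1, 0], [1, 2], by decide, by decide +kernel⟩,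
    ⟨⟨10133, [0, 1, 0, 0, 0, 0, 0, 0, 8, 0], [1, 9], by decide +kernel⟩,
      823, [0, 0, 0, 3, 17, 0, 0, 0, 8, 0, 1], [2, 7], by decide, by decide +kernel⟩,
    ⟨⟨5399, [0, 1, 0, 0, 0, 0, 0, 7, 0, 0, 10], [11], by decide +kernel⟩,
      211, [0, 0, 0, 3, 2, 0, 4, 18, 2, 17, 17, 2, 0], [1, 2, 3, 6], by decide, by decide +kernel⟩]

theorem hasCertificates_of_lt_140 {k : ℕ} (h : 130 ≤ k) (h' : k < 140) : HasCertificates k := by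
  interval_cases k
  exacts [
    ⟨⟨727, [0, 1, 0, 3, 0, 0, 1, 17, 1, 0, 0], [1, 3], by decide +kernel⟩,
      1741, [0, 1, 2, 0, 0, 0, 0, 0, 6, 0, 1], [2, 9], by decide, by decide +kernel⟩,
    ⟨⟨14813, [0, 0, 2, 1, 0, 0, 6, 0, 5, 0, 0, 2], [3, 9], by decide +kernel⟩,
      827, [0, 1, 0, 1, 1, 0, 3, 1, 0, 1, 0], [1, 2, 4], by decide, by decide +kernel⟩,
    ⟨⟨7949, [0, 1, 0, 0, 0, 0, 6, 0, 8, 0, 10, 0], [1, 11], by decide +kernel⟩,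
      8243, [0, 1, 0, 3, 0, 1, 2, 0, 8, 17, 4, 0, 1], [2, 4, 7], by decide, by decide +kernel⟩,
    ⟨⟨4373, [0, 1, 0, 0, 0, 5, 0, 0, 0, 0, 10], [11], by decide +kernel⟩,
      953, [0, 1, 0, 0, 0, 2, 0, 4, 8, 0, 1, 0], [1, 2, 9], by decide, by decide +kernel⟩,
    ⟨⟨4241, [0, 0, 0, 1, 0, 5, 0, 0, 8, 0, 0], [1, 9], by decide +kernel⟩,
      6353, [0, 1, 0, 0, 4, 0, 6, 0, 1, 1, 0, 1], [2, 3], by decide, by decide +kernel⟩,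
    ⟨⟨7951, [0, 0, 0, 3, 3, 17, 0, 7, 0, 0, 2, 0, 4], [5, 8], by decide +kernel⟩,
      3371, [0, 1, 1, 0, 3, 0, 2, 0, 0, 1, 0], [1, 2, 5], by decide, by decide +kernel⟩,
    ⟨⟨2887, [0, 0, 2, 0, 0, 0, 6, 0, 1, 1, 0], [1, 3, 7], by decide +kernel⟩,
      2417, [0, 1, 2, 0, 0, 0, 0, 5, 0, 7, 0, 1], [2, 10], by decide, by decide +kernel⟩,
    ⟨⟨151, [0, 1, 0, 3, 1, 0, 0, 3, 0, 1, 0, 3], [4, 8], by decide +kernel⟩,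
      2389, [0, 0, 0, 0, 3, 1, 0, 7, 0, 1, 0], [1, 2, 6], by decide, by decide +kernel⟩,
    ⟨⟨1213, [0, 0, 0, 0, 0, 2, 1, 2, 0, 0], [1, 5], by decide +kernel⟩,
      21407, [0, 1, 2, 0, 0, 5, 0, 0, 0, 7, 0, 1], [2, 10], by decide, by decide +kernel⟩,
    ⟨⟨4691, [0, 1, 0, 0, 4, 0, 0, 0, 0, 9, 0, 11], [12], by decide +kernel⟩,
      2269, [0, 0, 2, 2, 17, 17, 6, 0, 0, 4, 4, 17, 2, 0], [1, 2, 3, 5], by decide,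
        by decide +kernel⟩]

theorem hasCertificates_of_lt_150 {k : ℕ} (h : 140 ≤ k) (h' : k < 150) : HasCertificates k := by
  interval_cases k
  exacts [
    ⟨⟨5323, [0, 0, 1, 0, 0, 4, 0, 0, 0, 9, 9, 0], [1, 11], by decide +kernel⟩,
      4057, [0, 0, 0, 3, 1, 0, 6, 0, 0, 9, 0, 1], [2, 8], by decide, by decide +kernel⟩,
    ⟨⟨1889, [0, 0, 2, 0, 1, 1, 17, 0, 2, 0, 0, 2], [3, 6], by decide +kernel⟩,
      1733, [0, 0, 1, 17, 0, 0, 0, 7, 5, 0, 1, 0], [1, 2, 9], by decide, by decide +kernel⟩,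
    ⟨⟨11443, [0, 0, 0, 3, 2, 0, 0, 0, 8, 0, 8, 0], [1, 10], by decide +kernel⟩,
      3491, [0, 1, 0, 3, 1, 0, 2, 4, 34, 0, 2, 0, 1], [2, 5, 6], by decide, by decide +kernel⟩,
    ⟨⟨4001, [0, 1, 0, 0, 4, 0, 0, 7, 0, 9, 0, 11, 0, 13], [14], by decide +kernel⟩,
      367, [0, 0, 0, 3, 0, 0, 0, 0, 1, 0], [1, 2], by decide, by decide +kernel⟩,
    ⟨⟨313, [0, 1, 2, 1, 0, 3, 1, 0, 1, 1, 2, 0], [1, 4, 7], by decide +kernel⟩,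
      1511, [0, 1, 0, 3, 0, 5, 1, 0, 1, 1, 0, 1], [2, 3, 6], by decide, by decide +kernel⟩,
    ⟨⟨9739, [0, 0, 0, 3, 0, 5, 4, 0, 0, 0, 3, 0, 5], [6, 7], by decide +kernel⟩,
      6619, [0, 1, 0, 1, 0, 0, 0, 7, 0, 1, 0], [1, 2, 8], by decide, by decide +kernel⟩,
    ⟨⟨271, [0, 0, 0, 0, 2, 0, 4, 0, 1, 1, 0], [1, 3, 5], by decide +kernel⟩,
      563, [0, 0, 2, 0, 0, 5, 0, 1, 2, 1, 0, 1], [2, 4], by decide, by decide +kernel⟩,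
    ⟨⟨3371, [0, 1, 0, 0, 4, 0, 6, 0, 8, 0, 0, 11, 0, 13], [14], by decide +kernel⟩,
      653, [0, 1, 0, 0, 4, 1, 2, 0, 0, 1, 0], [1, 2, 7], by decide, by decide +kernel⟩,
    ⟨⟨269, [0, 1, 0, 0, 0, 5, 5, 0, 8, 0, 0, 10, 12, 0], [1, 13], by decide +kernel⟩,
      293, [0, 1, 0, 1, 0, 0, 6, 0, 0, 9, 0, 1], [2, 10], by decide, by decide +kernel⟩,
    ⟨⟨1877, [0, 1, 0, 3, 0, 0, 0, 0, 0, 0, 10], [11], by decide +kernel⟩,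
      1951, [0, 1, 0, 3, 0, 5, 0, 1, 1, 17, 17, 2, 0], [1, 2, 3], by decide, by decide +kernel⟩]

theorem hasCertificates_of_lt_160 {k : ℕ} (h : 150 ≤ k) (h' : k < 160) : HasCertificates k := by
  interval_cases k
  exacts [
    ⟨⟨10883, [0, 1, 2, 1, 0, 0, 0, 0, 8, 0, 0], [1, 8], by decide +kernel⟩,
      971, [0, 1, 0, 1, 0, 0, 6, 0, 0, 7, 0, 1], [2, 10], by decide, by decide +kernel⟩,
    ⟨⟨3371, [0, 0, 2, 1, 2, 0, 2, 5, 2, 3, 0, 0, 2], [3, 4, 6], by decide +kernel⟩,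
      1259, [0, 1, 0, 0, 3, 17, 1, 0, 0, 1, 0], [1, 2, 5], by decide, by decide +kernel⟩,
    ⟨⟨2339, [0, 1, 1, 2, 0, 0, 0, 7, 0, 0, 10, 0], [1, 11], by decide +kernel⟩,
      15413, [0, 0, 0, 3, 0, 1, 17, 1, 0, 3, 0, 1], [2, 6], by decide, by decide +kernel⟩,
    ⟨⟨331, [0, 1, 0, 3, 0, 0, 0, 7, 0, 9, 0, 0, 12], [13], by decide +kernel⟩,
      1181, [0, 0, 0, 3, 3, 0, 1, 3, 17, 4, 0, 1, 0], [1, 2, 4, 5], by decide, by decide +kernel⟩,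
    ⟨⟨20549, [0, 0, 2, 17, 1, 17, 1, 0, 0, 0, 0], [1, 5], by decide +kernel⟩,
      1409, [0, 1, 0, 3, 0, 5, 6, 1, 0, 1, 1, 0, 1], [2, 3, 7], by decide, by decide +kernel⟩,
    ⟨⟨743, [0, 1, 0, 3, 0, 0, 6, 0, 0, 0, 10, 0, 12], [13], by decide +kernel⟩,
      727, [0, 1, 0, 1, 0, 0, 4, 0, 0, 1, 0], [1, 2, 5], by decide, by decide +kernel⟩,
    ⟨⟨2143, [0, 1, 1, 0, 2, 1, 0, 7, 0, 1, 1, 0], [1, 3, 8], by decide +kernel⟩,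
      571, [0, 1, 0, 1, 0, 0, 4, 0, 0, 9, 0, 1], [2, 10], by decide, by decide +kernel⟩,
    ⟨⟨4003, [0, 1, 2, 0, 2, 17, 1, 1, 2, 0, 0, 0, 12], [5, 8], by decide +kernel⟩,
      167, [0, 1, 0, 1, 0, 0, 0, 7, 5, 0, 1, 0], [1, 2, 9], by decide, by decide +kernel⟩,
    ⟨⟨5153, [0, 1, 2, 1, 0, 3, 17, 17, 0, 3, 0, 2, 0], [1, 4, 6], by decide +kernel⟩,
      709, [0, 0, 0, 3, 0, 0, 6, 0, 8, 0, 6, 0, 1], [2, 9], by decide, by decide +kernel⟩,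
    ⟨⟨1621, [0, 1, 0, 3, 0, 0, 6, 0, 8, 0, 10, 0, 12, 0, 14], [15], by decide +kernel⟩,
      419, [0, 0, 0, 0, 0, 1, 1, 17, 17, 2, 0], [1, 2, 3], by decide, by decide +kernel⟩]

theorem hasCertificates_of_lt_170 {k : ℕ} (h : 160 ≤ k) (h' : k < 170) : HasCertificates k := by
  interval_cases k
  exacts [
    ⟨⟨3623, [0, 1, 1, 2, 0, 5, 0, 0, 0, 0, 10, 0], [1, 11], by decide +kernel⟩,
      2341, [0, 1, 1, 0, 0, 5, 5, 0, 1, 17, 1, 0, 1], [2, 4, 7], by decide, by decide +kernel⟩,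
    ⟨⟨5437, [0, 0, 2, 3, 0, 0, 0, 0, 8, 0, 0, 2], [3, 9], by decide +kernel⟩,
      3823, [0, 0, 2, 0, 0, 0, 0, 7, 0, 1, 0], [1, 2], by decide, by decide +kernel⟩,
    ⟨⟨571, [0, 1, 0, 3, 4, 1, 0, 0, 8, 0, 0, 0], [1, 7], by decide +kernel⟩,
      193, [0, 1, 1, 0, 0, 0, 0, 0, 6, 0, 1], [2, 9], by decide, by decide +kernel⟩,
    ⟨⟨491, [0, 1, 0, 3, 0, 5, 0, 0, 8, 0, 0, 11, 0, 13], [14], by decide +kernel⟩,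
      419, [0, 0, 0, 1, 1, 0, 6, 0, 0, 1, 0], [1, 2, 7], by decide, by decide +kernel⟩,
    ⟨⟨2621, [0, 1, 0, 0, 4, 0, 2, 17, 0, 0, 10, 4, 0], [1, 6, 7], by decide +kernel⟩,
      8623, [0, 1, 0, 1, 2, 1, 1, 2, 17, 2, 1, 0, 1], [2, 3, 5], by decide, by decide +kernel⟩,
    ⟨⟨6637, [0, 1, 0, 3, 0, 0, 2, 0, 8, 0, 1, 0, 3], [4, 9], by decide +kernel⟩,
      751, [0, 0, 2, 3, 17, 0, 0, 7, 0, 9, 0, 1, 0], [1, 2, 9], by decide, by decide +kernel⟩,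
    ⟨⟨11437, [0, 1, 0, 0, 0, 5, 0, 0, 2, 0, 0], [1, 3], by decide +kernel⟩,
      8867, [0, 1, 1, 0, 0, 0, 6, 0, 0, 7, 0, 1], [2, 10], by decide, by decide +kernel⟩,
    ⟨⟨449, [0, 1, 0, 3, 0, 5, 0, 7, 0, 0, 10, 0, 12, 0, 14], [15], by decide +kernel⟩,
      797, [0, 1, 0, 0, 0, 1, 0, 3, 0, 1, 0], [1, 2, 4], by decide, by decide +kernel⟩,
    ⟨⟨1301, [0, 0, 2, 0, 4, 0, 6, 0, 0, 0, 10, 3, 6, 0], [1, 6, 8], by decide +kernel⟩,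
      3697, [0, 1, 0, 0, 4, 0, 1, 1, 0, 2, 0, 1], [2, 5], by decide, by decide +kernel⟩,
    ⟨⟨2179, [0, 1, 0, 3, 0, 5, 0, 7, 0, 9, 0, 11, 0, 0, 14], [15], by decide +kernel⟩,
      4789, [0, 1, 0, 0, 2, 0, 2, 1, 17, 9, 36, 17, 2, 0], [1, 2, 3, 8], by decide,
        by decide +kernel⟩]

theorem hasCertificates_of_lt_180 {k : ℕ} (h : 170 ≤ k) (h' : k < 180) : HasCertificates k := by
  interval_cases k
  exacts [
    ⟨⟨4349, [0, 0, 0, 0, 0, 0, 0, 0, 0], [1], by decide +kernel⟩,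
      3637, [0, 0, 0, 3, 0, 1, 17, 0, 0, 3, 0, 1], [2, 6], by decide, by decide +kernel⟩,
    ⟨⟨4517, [0, 0, 2, 3, 0, 0, 0, 7, 0, 6, 0, 0, 2], [3, 10], by decide +kernel⟩,
      541, [0, 1, 0, 0, 1, 5, 2, 3, 0, 0, 1, 0], [1, 2, 8], by decide, by decide +kernel⟩,
    ⟨⟨599, [0, 0, 2, 1, 1, 1, 1, 0, 1, 1, 2, 0], [1, 4, 7], by decide +kernel⟩,
      2389, [0, 1, 1, 0, 0, 0, 4, 0, 0, 9, 0, 1], [2, 10], by decide, by decide +kernel⟩,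
    ⟨⟨2113, [0, 0, 0, 0, 0, 0, 6, 0, 0, 0, 10], [11], by decide +kernel⟩,
      2389, [0, 0, 0, 0, 4, 5, 17, 0, 2, 9, 0, 1, 0], [1, 2, 7], by decide, by decide +kernel⟩,
    ⟨⟨6637, [0, 0, 0, 0, 0, 0, 6, 0, 8, 0, 0], [1, 9], by decide +kernel⟩,
      1171, [0, 0, 2, 0, 1, 0, 3, 0, 5, 3, 2, 0, 1], [2, 3, 4], by decide, by decide +kernel⟩,
    ⟨⟨11311, [0, 1, 2, 1, 0, 3, 1, 0, 0, 0, 0, 4], [5, 6], by decide +kernel⟩,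
      5471, [0, 0, 0, 0, 1, 1, 17, 1, 0, 1, 0], [1, 2, 4], by decide, by decide +kernel⟩,
    ⟨⟨2339, [0, 1, 1, 0, 2, 0, 0, 7, 0, 1, 1, 0], [1, 3, 8], by decide +kernel⟩,
      13049, [0, 1, 0, 1, 17, 1, 0, 0, 0, 5, 0, 1], [2, 8], by decide, by decide +kernel⟩,
    ⟨⟨9829, [0, 1, 0, 0, 4, 5, 0, 2, 0, 1, 0, 0, 4], [5, 8], by decide +kernel⟩,
      1753, [0, 0, 2, 3, 1, 0, 0, 0, 8, 0, 1, 0], [1, 2, 8], by decide, by decide +kernel⟩,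
    ⟨⟨3203, [0, 0, 0, 0, 0, 5, 0, 7, 0, 0, 0], [1, 8], by decide +kernel⟩,
      4483, [0, 1, 1, 0, 4, 0, 0, 0, 0, 7, 0, 1], [2, 10], by decide, by decide +kernel⟩,
    ⟨⟨5711, [0, 1, 0, 3, 0, 1, 17, 1, 1, 0, 1, 0, 3], [4, 5], by decide +kernel⟩,
      1621, [0, 0, 0, 3, 0, 1, 1, 0, 3, 17, 2, 0], [1, 2, 3], by decide, by decide +kernel⟩]

theorem hasCertificates_of_lt_190 {k : ℕ} (h : 180 ≤ k) (h' : k < 190) : HasCertificates k := by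
  interval_cases k
  exacts [
    ⟨⟨3037, [0, 0, 0, 0, 0, 0, 5, 7, 0, 0, 10, 10, 0], [1, 12], by decide +kernel⟩,
      839, [0, 1, 0, 1, 0, 3, 0, 5, 0, 0, 10, 0, 1], [2, 11], by decide, by decide +kernel⟩,
    ⟨⟨7963, [0, 0, 2, 17, 1, 0, 0, 0, 5, 0, 0, 2], [3, 9], by decide +kernel⟩,
      2609, [0, 1, 0, 0, 4, 0, 1, 5, 17, 4, 0, 1, 0], [1, 2, 4, 5], by decide, by decide +kernel⟩,
    ⟨⟨8627, [0, 0, 0, 0, 4, 0, 0, 0, 8, 0, 0], [1, 9], by decide +kernel⟩,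
      761, [0, 0, 0, 3, 0, 0, 2, 0, 8, 0, 10, 0, 1], [2, 9], by decide, by decide +kernel⟩,
    ⟨⟨3191, [0, 0, 0, 3, 4, 1, 1, 0, 0, 0, 3, 0, 5], [6, 7], by decide +kernel⟩,
      967, [0, 0, 0, 3, 3, 0, 5, 1, 0, 0, 1, 0], [1, 2, 5], by decide, by decide +kernel⟩,
    ⟨⟨1217, [0, 0, 0, 0, 0, 4, 0, 0, 7, 0, 10, 0], [1, 11], by decide +kernel⟩,
      1747, [0, 1, 2, 1, 1, 2, 17, 1, 0, 1, 1, 0, 1], [2, 3, 7], by decide, by decide +kernel⟩,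
    ⟨⟨283, [0, 0, 0, 0, 4, 0, 0, 7, 0, 9, 0, 0, 12], [13], by decide +kernel⟩,
      20899, [0, 0, 2, 1, 0, 2, 0, 0, 8, 0, 1, 0], [1, 2, 7], by decide, by decide +kernel⟩,
    ⟨⟨4421, [0, 0, 0, 1, 0, 3, 0, 2, 17, 2, 1, 0], [1, 3, 4], by decide +kernel⟩,
      337, [0, 0, 0, 0, 4, 1, 17, 2, 17, 0, 2, 0, 1], [2, 5, 7], by decide, by decide +kernel⟩,
    ⟨⟨947, [0, 0, 0, 0, 4, 0, 6, 0, 0, 0, 10, 0, 12], [13], by decide +kernel⟩,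
      5849, [0, 0, 2, 3, 0, 2, 0, 2, 8, 0, 0, 1, 0], [1, 2, 8], by decide, by decide +kernel⟩,
    ⟨⟨7907, [0, 0, 0, 0, 4, 0, 6, 0, 0, 0, 9, 11, 0], [1, 12], by decide +kernel⟩,
      1427, [0, 1, 0, 0, 4, 0, 6, 0, 1, 17, 1, 0, 1], [2, 4], by decide, by decide +kernel⟩,
    ⟨⟨22699, [0, 0, 0, 0, 4, 0, 6, 0, 8, 0, 0, 0, 12], [13], by decide +kernel⟩,
      797, [0, 1, 2, 0, 2, 1, 1, 17, 2, 1, 17, 17, 2, 0], [1, 2, 3, 7], by decide,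
        by decide +kernel⟩]

theorem hasCertificates_of_lt_200 {k : ℕ} (h : 190 ≤ k) (h' : k < 200) : HasCertificates k := by
  interval_cases k
  exacts [
    ⟨⟨23041, [0, 1, 2, 0, 2, 0, 0, 5, 20, 18, 1, 0, 0], [1, 4, 6], by decide +kernel⟩,
      2557, [0, 1, 1, 0, 0, 3, 0, 0, 6, 0, 10, 0, 1], [2, 11], by decide, by decide +kernel⟩,
    ⟨⟨7109, [0, 0, 2, 0, 0, 2, 1, 0, 2, 0, 0, 2], [3, 6], by decide +kernel⟩,
      12743, [0, 1, 0, 0, 0, 0, 0, 0, 1, 0], [1, 2], by decide, by decide +kernel⟩,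
    ⟨⟨541, [0, 0, 0, 0, 3, 1, 17, 0, 0, 0, 10, 0], [1, 6], by decide +kernel⟩,
      4357, [0, 1, 0, 0, 0, 0, 0, 0, 8, 0, 1], [2, 9], by decide, by decide +kernel⟩,
    ⟨⟨16417, [0, 1, 0, 3, 17, 1, 0, 0, 4, 0, 1, 0, 3], [4, 9], by decide +kernel⟩,
      659, [0, 1, 0, 0, 0, 0, 0, 7, 0, 1, 0], [1, 2, 8], by decide, by decide +kernel⟩,
    ⟨⟨347, [0, 0, 0, 3, 0, 0, 0, 7, 0, 0, 0], [1, 8], by decide +kernel⟩,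
      9043, [0, 1, 0, 1, 0, 0, 2, 17, 5, 18, 1, 0, 1], [2, 3, 6], by decide, by decide +kernel⟩,
    ⟨⟨2791, [0, 0, 0, 3, 0, 0, 0, 7, 0, 0, 10, 0, 12], [13], by decide +kernel⟩,
      1483, [0, 1, 0, 3, 0, 0, 1, 0, 3, 0, 1, 0], [1, 2, 4], by decide, by decide +kernel⟩,
    ⟨⟨5813, [0, 0, 0, 3, 4, 1, 1, 0, 8, 0, 1, 1, 0], [1, 3, 8], by decide +kernel⟩,
      4909, [0, 1, 0, 0, 0, 0, 6, 0, 0, 9, 0, 1], [2, 10], by decide, by decide +kernel⟩,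
    ⟨⟨7757, [0, 0, 0, 3, 0, 0, 6, 0, 0, 0, 0, 11], [12], by decide +kernel⟩,
      3463, [0, 0, 0, 3, 0, 1, 1, 17, 1, 0, 1, 0], [1, 2, 4], by decide, by decide +kernel⟩,
    ⟨⟨1669, [0, 0, 0, 0, 0, 3, 0, 0, 8, 7, 0, 0], [1, 10], by decide +kernel⟩,
      7369, [0, 1, 0, 0, 0, 0, 0, 5, 0, 9, 0, 1], [2, 10], by decide, by decide +kernel⟩,
    ⟨⟨1583, [0, 0, 0, 3, 0, 0, 6, 0, 0, 9, 0, 11, 0, 13], [14], by decide +kernel⟩,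
      2251, [0, 0, 2, 0, 0, 2, 0, 0, 3, 17, 2, 0], [1, 2, 3], by decide, by decide +kernel⟩]

/-! ### Conclusion -/

theorem hasCertificates_of_lt {k : ℕ} (h : 1 ≤ k) (h' : k < 200) : HasCertificates k := by
  rcases lt_or_ge k 10 with h10 | h10
  · exact hasCertificates_of_lt_10 h h10
  rcases lt_or_ge k 20 with h20 | h20
  · exact hasCertificates_of_lt_20 h10 h20
  rcases lt_or_ge k 30 with h30 | h30
  · exact hasCertificates_of_lt_30 h20 h30
  rcases lt_or_ge k 40 with h40 | h40
  · exact hasCertificates_of_lt_40 h30 h40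
  rcases lt_or_ge k 50 with h50 | h50
  · exact hasCertificates_of_lt_50 h40 h50
  rcases lt_or_ge k 60 with h60 | h60
  · exact hasCertificates_of_lt_60 h50 h60
  rcases lt_or_ge k 70 with h70 | h70
  · exact hasCertificates_of_lt_70 h60 h70
  rcases lt_or_ge k 80 with h80 | h80
  · exact hasCertificates_of_lt_80 h70 h80
  rcases lt_or_ge k 90 with h90 | h90
  · exact hasCertificates_of_lt_90 h80 h90
  rcases lt_or_ge k 100 with h100 | h100
  · exact hasCertificates_of_lt_100 h90 h100
  rcases lt_or_ge k 110 with h110 | h110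
  · exact hasCertificates_of_lt_110 h100 h110
  rcases lt_or_ge k 120 with h120 | h120
  · exact hasCertificates_of_lt_120 h110 h120
  rcases lt_or_ge k 130 with h130 | h130
  · exact hasCertificates_of_lt_130 h120 h130
  rcases lt_or_ge k 140 with h140 | h140
  · exact hasCertificates_of_lt_140 h130 h140
  rcases lt_or_ge k 150 with h150 | h150
  · exact hasCertificates_of_lt_150 h140 h150
  rcases lt_or_ge k 160 with h160 | h160
  · exact hasCertificates_of_lt_160 h150 h160
  rcases lt_or_ge k 170 with h170 | h170
  · exact hasCertificates_of_lt_170 h160 h170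
  rcases lt_or_ge k 180 with h180 | h180
  · exact hasCertificates_of_lt_180 h170 h180
  rcases lt_or_ge k 190 with h190 | h190
  · exact hasCertificates_of_lt_190 h180 h190
  exact hasCertificates_of_lt_200 h190 h'

theorem proposition6p3 (g : ℕ) (hg : 1 < g) (hg' : g ≤ 200) (y : ℕ → ℤ)
    (hy : ∀ i : ℕ, 1 ≤ i → i ≤ g - 1 → y i = (i : ℤ) + 1) :
    Irreducible ((ExplicitMulticurve.matM y g).charpoly.map (Int.castRingHom ℚ)) ∧
      Irreducible
        ((ExplicitMulticurve.matN y g ((g : ℤ) + 1)).charpoly.map (Int.castRingHom ℚ)) := by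
  obtain ⟨k, rfl⟩ : ∃ k, g = k + 1 := ⟨g - 1, by omega⟩
  exact irreducible_of_hasCertificates (hasCertificates_of_lt (by omega) (by omega)) y
    fun i h1 h2 => hy i h1 (by omega)
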